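/- **Setting.** Let $\mathcal O\subset\mathbb R^m$ be open and convex (for instance $\mathcal O=\mathbb R^m$) and $\mathcal X=\mathcal O\times\mathbb R^m$. Let $V:\mathcal O\to\mathbb R$ and $D:\mathcal O\to\mathbb R^{m\times m}$ be $C^\infty$, with $V$ bounded from below, $D(q)$ symmetric, $a\,\mathrm I_m\le D(q)\le b\,\mathrm I_m$ for constants $0<a\le b<\infty$, and such that $V$, $D$ and all their derivatives grow at most polynomially. Put $$H(q,p)=V(q)-\tfrac12\ln\det D(q)+\tfrac12\,p^{\mathsf T}D(q)p .$$ *Schemes.* Let $\Phi_{\Delta t}:\mathcal X\times\mathcal X^k\to\mathcal X^k$ be one of the following two maps. Implicit Midpoint Rule (IMR, $k=1$): with $(\bar q,\bar p)=\big(\tfrac{q+q_1}2,\tfrac{p+p_1}2\big)$, $$\Phi_{\Delta t}(q,p,q_1,p_1)=\big(q_1-q-\Delta t\nabla_pH(\bar q,\bar p),\;p_1-p+\Delta t\nabla_qH(\bar q,\bar p)\big).$$ Generalized Störmer–Verlet (GSV, $k=2$): $\Phi_{\Delta t}(q,p,q_1,p_1,q_2,p_2)$ has the components $$q_1-q-\tfrac{\Delta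 t}2\nabla_pH(q,p_1),\quad p_1-p+\tfrac{\Delta t}2\nabla_qH(q,p_1),\quad q_2-q_1-\tfrac{\Delta t}2\nabla_pH(q_2,p_1),\quad p_2-p_1+\tfrac{\Delta t}2\nabla_qH(q_2,p_1).$$ *Solver.* Let $\Delta t_\star>0$. For each $\Delta t\in(0,\Delta t_\star]$ let $\chi_{\Delta t}=(\chi_{\Delta t,1},\dots,\chi_{\Delta t,k}):\mathcal A_{\Delta t}\to\mathcal X^k$ be a numerical solver, that is, a continuous map on a nonempty open set $\mathcal A_{\Delta t}\subset\mathcal X$ with $\Phi_{\Delta t}(x,\chi_{\Delta t}(x))=0$ and $\nabla_y\Phi_{\Delta t}(x,\chi_{\Delta t}(x))$ invertible for all $x\in\mathcal A_{\Delta t}$. Assume that for each $x\in\mathcal X$ there are $\tau>0$ and $C\ge 0$ (depending on $x$) with $\|\chi_{\Delta t,i}(x)-x\|\le C\Delta t$ for all $i$ and all $\Delta t\in(0,\min(\tau,\Delta t_\star)]$ with $x\in\mathcal A_{\Delta t}$. Write $\varphi_{\Delta t}=\chi_{\Delta t,k}$, $S(q,p)=(q,-p)$, $\psi_{\Delta t}=S\circ\varphi_{\Delta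 t}$, let $$\mathcal B_{\Delta t}=\Big\{x\in\mathcal A_{\Delta t}:\ \psi_{\Delta t}(x)\in\mathcal A_{\Delta t},\ \chi_{\Delta t}(\psi_{\Delta t}(x))=\big(S\chi_{\Delta t,k-1}(x),\dots,S\chi_{\Delta t,1}(x),S(x)\big)\Big\}$$ be the set of configurations that pass the reversibility check, and put $\psi^{\mathrm{rev}}_{\Delta t}(x)=\psi_{\Delta t}(x)$ for $x\in\mathcal B_{\Delta t}$ and $\psi^{\mathrm{rev}}_{\Delta t}(x)=x$ for $x\in\mathcal X\setminus\mathcal B_{\Delta t}$. *One step of HMC with reversibility check.* From $q^0\in\mathcal O$, draw independent $G\sim\mathcal N(0,\mathrm I_m)$ and $U$ uniform on $[0,1]$, put $x=(q^0,D(q^0)^{-1/2}G)$ and $y=\psi^{\mathrm{rev}}_{\Delta t}(x)$; let $q^1$ be the position of $y$ if $U\le\exp(-H(y)+H(x))$, and $q^1=q^0$ otherwise. *Overdamped Langevin dynamics.* For each $q^0\in\mathcal O$ let $(q_t)_{t\ge0}$ be a solution in $\mathcal O$ (a continuous process solving the martingale problem) of $$\mathrm dq_t=\big(-D(q_t)\nabla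 V(q_t)+\operatorname{div}D(q_t)\big)\,\mathrm dt+\sqrt{2D(q_t)}\,\mathrm dW_t,\qquad q_0=q^0,$$ with $(\operatorname{div}D)_i=\sum_j\partial_{q_j}D_{i,j}$ and generator $\mathcal Lf=(-D\nabla V+\operatorname{div}D)^{\mathsf T}\nabla f+D:\nabla^2f$, and write $(\mathrm e^{t\mathcal L}f)(q)=\mathbb E^q[f(q_t)]$. **Hypotheses.** Let $f:\mathcal O\to\mathbb R$ be smooth and grow at most polynomially together with all its derivatives. Assume that there are $K,\delta\ge0$ and $r_3>0$ such that: 1. for all $t\in(0,\Delta t_\star]$ and $q\in\mathcal O$, $f(q_t)$ is integrable under $\mathbb P^q$ and $\big|\big(\mathrm e^{t\mathcal L}f-f-t\mathcal Lf\big)(q)\big|\le Kt^2(1+\|q\|^\delta)$; 2. for all $\Delta t\in(0,\Delta t_\star]$ and $(q,p)\in\mathcal A_{\Delta t}$, the solution $\phi_t(q,p)$ of the Hamiltonian dynamics $\dot q=\nabla_pH$, $\dot p=-\nabla_qH$ exists in $\mathcal X$ on $[0,\Delta t]$, and $\|\varphi_{\Delta t}(q,p)-\phi_{\Delta t}(q,p)\|\le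 K\Delta t^3(1+\|q\|^\delta+\|p\|^\delta)$; 3. for every integer $n\ge0$ there are $C_n,b_n\ge0$ such that, for all $\Delta t\in(0,\Delta t_\star]$ and $q\in\mathcal O$, with $G\sim\mathcal N(0,\mathrm I_m)$, $$\mathbb E_G\Big[\|G\|^n\,\mathbb 1_{(q,D(q)^{-1/2}G)\notin\mathcal B_{\Delta t}}\Big]\le C_n(1+\|q\|^{b_n})\,\Delta t^{2(r_3+1)} .$$ **Conclusion.** There are $C,\alpha\ge0$ such that for all $\Delta t\in(0,\Delta t_\star]$ with $\Delta t^2/2\le\Delta t_\star$ (automatic if $\Delta t_\star\le2$) and all $q^0\in\mathcal O$, the variable $f(q^1)$ is integrable and $$\Big|\mathbb E^{q^0}[f(q^1)]-\mathbb E^{q^0}[f(q_{\Delta t^2/2})]\Big|\le C\,(1+\|q^0\|^\alpha)\,\Delta t^{2(\min(1,r_3)+1)} .$$ -/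

import Mathlib

open MeasureTheory ProbabilityTheory Set
open scoped NNReal ContDiff Matrix MatrixOrder

noncomputable section

namespace RMHMC

/-- Positions and momenta live in `ℝᵐ` with its Euclidean norm. -/
abbrev E (m : ℕ) : Type := EuclideanSpace ℝ (Fin m)

/-- Phase space `ℝᵐ × ℝᵐ`. Norms on it only enter through bounds with unspecified constants,
so the maximum norm of the product is as good as the Euclidean norm of `ℝ²ᵐ`. -/
abbrev X (m : ℕ) : Type := E m × E m

/-- The configuration space `𝒪 × ℝᵐ`. -/
def conf {m : ℕ} (O : Set (E m)) : Set (X m) := {x | x.1 ∈ O}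

/-- The partial derivative `∂g/∂qᵢ` at `q`. -/
def pd {m : ℕ} (i : Fin m) (g : E m → ℝ) (q : E m) : ℝ :=
  fderiv ℝ g q (EuclideanSpace.single i 1)

/-- `g` is smooth on the (open) set `O`, and `g` and all its derivatives grow at most
polynomially on `O`. -/
def SmoothPoly {m : ℕ} (O : Set (E m)) (g : E m → ℝ) : Prop :=
  ContDiffOn ℝ ∞ g O ∧
    ∀ n : ℕ, ∃ C : ℝ, ∃ N : ℕ, ∀ q ∈ O, ‖iteratedFDeriv ℝ n g q‖ ≤ C * (1 + ‖q‖ ^ N)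

/-- The standing conditions on the potential `V` and the diffusion coefficient `D`. The two
semidefiniteness conditions say that `D q` is symmetric with `a I ≤ D q ≤ b I`. -/
structure Admissible {m : ℕ} (O : Set (E m)) (V : E m → ℝ)
    (D : E m → Matrix (Fin m) (Fin m) ℝ) (a b c : ℝ) : Prop where
  a_pos : 0 < a
  a_le_b : a ≤ b
  posDef : ∀ q ∈ O, (D q).PosDef
  lower : ∀ q ∈ O, (D q - a • (1 : Matrix (Fin m) (Fin m) ℝ)).PosSemidef
  upper : ∀ q ∈ O, (b • (1 : Matrix (Fin m) (Fin m) ℝ) - D q).PosSemidef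
  V_ge : ∀ q ∈ O, c ≤ V q
  V_smooth : SmoothPoly O V
  D_smooth : ∀ i j, SmoothPoly O (fun q => D q i j)

/-- `H(q,p) = V(q) - ½ ln det D(q) + ½ pᵀ D(q) p`. -/
def ham {m : ℕ} (V : E m → ℝ) (D : E m → Matrix (Fin m) (Fin m) ℝ) (x : X m) : ℝ :=
  V x.1 - (1 / 2) * Real.log (D x.1).det + (1 / 2) * (x.2.ofLp ⬝ᵥ (D x.1 *ᵥ x.2.ofLp))

/-- `∇_q H`. -/
def gradQ {m : ℕ} (H : X m → ℝ) (x : X m) : E m := gradient (fun q => H (q, x.2)) x.1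

/-- `∇_p H`. -/
def gradP {m : ℕ} (H : X m → ℝ) (x : X m) : E m := gradient (fun p => H (x.1, p)) x.2

/-- `γ` solves the Hamiltonian dynamics `q' = ∇_p H`, `p' = -∇_q H` on `[0, T]`, inside
`𝒪 × ℝᵐ`, with initial condition `x`. -/
def IsHamTrajectory {m : ℕ} (O : Set (E m)) (H : X m → ℝ) (T : ℝ) (x : X m)
    (γ : ℝ → X m) : Prop :=
  γ 0 = x ∧ ∀ t ∈ Icc 0 T, γ t ∈ conf O ∧
    HasDerivWithinAt γ (gradP H (γ t), -gradQ H (γ t)) (Icc 0 T) t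

/-- The two implicit schemes. -/
inductive Scheme where
  | imr : Scheme
  | gsv : Scheme

/-- The number `k - 1` of intermediate configurations. -/
def Scheme.inner : Scheme → ℕ
  | .imr => 0
  | .gsv => 1

/-- The Implicit Midpoint Rule, with `y 0 = (q₁, p₁)`. -/
def phiIMR {m : ℕ} (H : X m → ℝ) (dt : ℝ) (x : X m) (y : Fin 1 → X m) : Fin 1 → X m :=
  fun _ =>
    let z : X m := (1 / 2 : ℝ) • (x + y 0)
    ((y 0).1 - x.1 - dt • gradP H z, (y 0).2 - x.2 + dt • gradQ H z)

/-- The Generalized Störmer--Verlet scheme, with `y 0 = (q₁, p₁)` and `y 1 = (q₂, p₂)`. -/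
def phiGSV {m : ℕ} (H : X m → ℝ) (dt : ℝ) (x : X m) (y : Fin 2 → X m) : Fin 2 → X m :=
  ![((y 0).1 - x.1 - (dt / 2) • gradP H (x.1, (y 0).2),
      (y 0).2 - x.2 + (dt / 2) • gradQ H (x.1, (y 0).2)),
    ((y 1).1 - (y 0).1 - (dt / 2) • gradP H ((y 1).1, (y 0).2),
      (y 1).2 - (y 0).2 + (dt / 2) • gradQ H ((y 1).1, (y 0).2))]

/-- The numerical scheme `Φ_Δt : 𝒳 × 𝒳ᵏ → 𝒳ᵏ`, where `k = s.inner + 1`. -/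
def Scheme.phi {m : ℕ} (s : Scheme) (H : X m → ℝ) (dt : ℝ) :
    X m → (Fin (s.inner + 1) → X m) → (Fin (s.inner + 1) → X m) :=
  match s with
  | .imr => phiIMR H dt
  | .gsv => phiGSV H dt

/-- `χ` is a numerical solver on `A` for the scheme `Φ`; only its values on `A` matter. -/
structure IsNumericalSolver {m n : ℕ} (O : Set (E m))
    (Φ : X m → (Fin (n + 1) → X m) → (Fin (n + 1) → X m))
    (A : Set (X m)) (χ : X m → Fin (n + 1) → X m) : Prop where
  isOpen : IsOpen A
  nonempty : A.Nonempty
  subset : A ⊆ conf O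
  mapsTo : ∀ x ∈ A, ∀ i, χ x i ∈ conf O
  continuousOn : ContinuousOn χ A
  solves : ∀ x ∈ A, Φ x (χ x) = 0
  invertible : ∀ x ∈ A, (fderiv ℝ (Φ x) (χ x)).IsInvertible

/-- The numerical flow `φ`: the last component of the solver. -/
def flow {m n : ℕ} (χ : X m → Fin (n + 1) → X m) (x : X m) : X m := χ x (Fin.last n)

/-- Momentum reversal. -/
def S {m : ℕ} (x : X m) : X m := (x.1, -x.2)

/-- `ψ = S ∘ φ`. -/
def psi {m n : ℕ} (χ : X m → Fin (n + 1) → X m) (x : X m) : X m := S (flow χ x)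

/-- The set `ℬ` of configurations which pass the reversibility check:
`χ(ψ(x)) = (S χ_{k-1}(x), …, S χ_1(x), S x)`, where `k = n + 1`. In the list
`(x, χ_1(x), …, χ_k(x))`, numbered from zero, the entry that is compared with the component
`j` of `χ(ψ(x))` (also numbered from zero) has the number `k - 1 - j`. -/
def revSet {m n : ℕ} (A : Set (X m)) (χ : X m → Fin (n + 1) → X m) : Set (X m) :=
  {x | x ∈ A ∧ psi χ x ∈ A ∧
    ∀ j : Fin (n + 1),
      χ (psi χ x) j = S ((Fin.cons x (χ x) : Fin (n + 2) → X m) (Fin.rev j).castSucc)}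

open Classical in
/-- `ψ^rev`: the proposal with reversibility check. -/
def psiRev {m n : ℕ} (A : Set (X m)) (χ : X m → Fin (n + 1) → X m) (x : X m) : X m :=
  if x ∈ revSet A χ then psi χ x else x

/-- The momentum `M^{-1/2} g`. -/
def invSqrtMul {m : ℕ} (M : Matrix (Fin m) (Fin m) ℝ) (g : E m) : E m :=
  WithLp.toLp 2 ((CFC.sqrt M)⁻¹ *ᵥ g.ofLp)

open Classical in
/-- The position after one step of HMC with reversibility check, started at the position `q`,
with momentum `D(q)^{-1/2} g` and with the uniform variable `u` of the Metropolis test. -/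
def hmcPosition {m n : ℕ} (V : E m → ℝ) (D : E m → Matrix (Fin m) (Fin m) ℝ)
    (A : Set (X m)) (χ : X m → Fin (n + 1) → X m) (q : E m) (g : E m) (u : ℝ) : E m :=
  let x : X m := (q, invSqrtMul (D q) g)
  let y : X m := psiRev A χ x
  if u ≤ Real.exp (-ham V D y + ham V D x) then y.1 else q

/-- The joint law of the Gaussian variable `G ∼ 𝒩(0, I)` and of an independent uniform
variable on `[0,1]`. -/
def noise (m : ℕ) : Measure (E m × ℝ) :=
  (stdGaussian (E m)).prod (volume.restrict (Icc (0 : ℝ) 1))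

/-- The generator `ℒ f = (-D∇V + div D)ᵀ ∇f + D : ∇²f`. -/
def gen {m : ℕ} (V : E m → ℝ) (D : E m → Matrix (Fin m) (Fin m) ℝ) (f : E m → ℝ)
    (q : E m) : ℝ :=
  ∑ i, (-(∑ j, D q i j * pd j V q) + ∑ j, pd j (fun q' => D q' i j) q) * pd i f q
    + ∑ i, ∑ j, D q i j * pd i (pd j f) q

/-- The process `Y` (under `P`) is a solution in `𝒪`, started at `q`, of the overdamped Langevin
dynamics `dq = (-D∇V + div D) dt + √(2D) dW`, in the sense of the martingale problem for its
generator. -/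
structure SolvesLangevin {m : ℕ} {Ω : Type*} [mΩ : MeasurableSpace Ω] (O : Set (E m))
    (V : E m → ℝ) (D : E m → Matrix (Fin m) (Fin m) ℝ) (q : E m)
    (P : Measure Ω) (Y : ℝ≥0 → Ω → E m) : Prop where
  prob : IsProbabilityMeasure P
  init : ∀ᵐ w ∂P, Y 0 w = q
  paths : ∀ᵐ w ∂P, Continuous (fun t => Y t w) ∧ ∀ t, Y t w ∈ O
  martingale : ∃ ℱ : Filtration ℝ≥0 mΩ, StronglyAdapted ℱ Y ∧
    ∀ g : E m → ℝ, ContDiff ℝ ∞ g → HasCompactSupport g → tsupport g ⊆ O →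
      Martingale (fun t w => g (Y t w) - g (Y 0 w)
        - ∫ r in (0 : ℝ)..t, gen V D g (Y r.toNNReal w)) ℱ P

end RMHMC

end

/-!
The average of `f` after one step of the algorithm and the average of `f` under the Langevin
semigroup at time `Δt² / 2` are both equal to `f + (Δt² / 2) ℒ f` up to the claimed error. For the
semigroup this is a hypothesis, so all the work concerns the algorithm.

*Rejection.* Along the exact Hamiltonian flow the energy is conserved, which bounds the momentum
and the displacement polynomially (`IsHamTrajectory.ham_eq`, `polyOVec_trajectory`). As the
numerical flow is within `O(Δt³)` of the exact one, the proposal moves the position by `O(Δt)` and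
changes the energy by `O(Δt³)` (`polyOVec_flow`). A rejection thus costs
`|f(y) - f(q)| |H(y) - H(x)| = O(Δt⁴)` only.

*Proposal.* The local error `O(Δt³)` alone would not be good enough: one has to see that the terms
of order `Δt` and `Δt³` are odd in the momentum and average out. Instead of computing the expansion
up to third order, one compares the final positions `u`, `v` which belong to the momenta `p` and
`-p`. By time reversal `v` is obtained from `(q, p)` with the step `-Δt` (`HalfStep.reverse`), so
that `u` and `v` are symmetric around `q` up to `O(Δt²)`. Expanding around the midpoint of `u` and
`v`, where odd differences cancel identically (`SymmPair.polyO_even`, `SymmPair.polyO_odd`),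
gives `½ (f(u) + f(v)) = f(q) + (Δt² / 2) Q(q, p) + O(Δt⁴)` with an explicit `Q`
(`HalfStep.polyO_average`). Both schemes have the common form `HalfStep` and are treated together.

*Averaging.* The momentum is centred Gaussian with covariance `D(q)⁻¹`, and the average of `Q` is
`ℒ f`, by Jacobi's formula for the derivative of `ln det D` (`hasMean_secondOrder`). The
symmetrization is legitimate on the set where the reversibility check succeeds for `p` and for
`-p`; the complement of this set contributes `O(Δt^(2 (r₃ + 1)))` by hypothesis
(`abs_integral_sub_le_of_symm`).

All remainders are uniform up to a power of `1 + ‖q‖ + ‖p‖`; the predicate `PolyO` expresses this,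
and turns the expansions into a calculus of orders.
-/

namespace RMHMC

/-! ### Smooth functions of polynomial growth -/

theorem one_add_pow_le (x : ℝ) (hx : 0 ≤ x) (N : ℕ) : (1 + x) ^ N ≤ 2 ^ N * (1 + x ^ N) := by
  refine (add_pow_le zero_le_one hx N).trans ?_
  rw [one_pow]
  gcongr <;> norm_num

theorem one_add_pow_ge (x : ℝ) (hx : 0 ≤ x) (N : ℕ) : 1 + x ^ N ≤ 2 * (1 + x) ^ N := by
  have h1 : (1 : ℝ) ≤ (1 + x) ^ N := one_le_pow₀ (by linarith)
  have h2 : x ^ N ≤ (1 + x) ^ N := by gcongr; linarith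
  linarith

section SmoothPoly

variable {m : ℕ} {O : Set (E m)} {g h : E m → ℝ}

theorem SmoothPoly.contDiffAt (hg : SmoothPoly O g) (hO : IsOpen O) {q : E m} (hq : q ∈ O) :
    ContDiffAt ℝ ∞ g q := hg.1.contDiffAt (hO.mem_nhds hq)

/-- The derivatives up to a given order obey a common polynomial bound, here with the weight
`(1 + ‖q‖) ^ N`, which is more convenient than `1 + ‖q‖ ^ N`. -/
theorem SmoothPoly.bound (hg : SmoothPoly O g) (n : ℕ) :
    ∃ C : ℝ, 1 ≤ C ∧ ∃ N : ℕ, ∀ i ≤ n, ∀ q ∈ O,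
      ‖iteratedFDeriv ℝ i g q‖ ≤ C * (1 + ‖q‖) ^ N := by
  have key : ∀ i, ∃ C : ℝ, 1 ≤ C ∧ ∃ N : ℕ, ∀ q ∈ O,
      ‖iteratedFDeriv ℝ i g q‖ ≤ C * (1 + ‖q‖) ^ N := by
    intro i
    obtain ⟨C, N, hC⟩ := hg.2 i
    refine ⟨2 * |C| + 1, by linarith [abs_nonneg C], N, fun q hq => (hC q hq).trans ?_⟩
    have h0 := one_add_pow_ge ‖q‖ (norm_nonneg q) N
    have h1 : (0 : ℝ) ≤ (1 + ‖q‖) ^ N := by positivity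
    have h2 : C * (1 + ‖q‖ ^ N) ≤ |C| * (1 + ‖q‖ ^ N) := by gcongr; exact le_abs_self C
    have h3 : |C| * (1 + ‖q‖ ^ N) ≤ |C| * (2 * (1 + ‖q‖) ^ N) := by gcongr
    linarith
  induction n with
  | zero =>
    obtain ⟨C, hC, N, h⟩ := key 0
    exact ⟨C, hC, N, fun i hi => by obtain rfl : i = 0 := by omega
                                    exact h⟩
  | succ n ih =>
    obtain ⟨C, hC, N, h⟩ := ih
    obtain ⟨C', hC', N', h'⟩ := key (n + 1)
    refine ⟨C + C', by linarith, N + N', fun i hi q hq => ?_⟩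
    have hq1 : (1 : ℝ) ≤ 1 + ‖q‖ := by linarith [norm_nonneg q]
    rcases Nat.lt_or_ge i (n + 1) with h1 | h1
    · refine (h i (by omega) q hq).trans ?_
      gcongr
      · linarith
      · omega
    · obtain rfl : i = n + 1 := by omega
      refine (h' q hq).trans ?_
      gcongr
      · linarith
      · omega

theorem SmoothPoly.of_bound (hO : IsOpen O) (hg : ContDiffOn ℝ ∞ g O)
    (hb : ∀ n : ℕ, ∃ C : ℝ, ∃ N : ℕ, ∀ q ∈ O,
      ‖iteratedFDerivWithin ℝ n g O q‖ ≤ C * (1 + ‖q‖) ^ N) : SmoothPoly O g := by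
  refine ⟨hg, fun n => ?_⟩
  obtain ⟨C, N, h⟩ := hb n
  refine ⟨|C| * 2 ^ N, N, fun q hq => ?_⟩
  rw [← iteratedFDerivWithin_of_isOpen n hO hq]
  refine (h q hq).trans ?_
  rw [mul_assoc]
  gcongr
  · exact le_abs_self C
  · exact one_add_pow_le _ (norm_nonneg q) N

theorem SmoothPoly.boundWithin (hO : IsOpen O) (hg : SmoothPoly O g) (n : ℕ) :
    ∃ C : ℝ, 1 ≤ C ∧ ∃ N : ℕ, ∀ i ≤ n, ∀ q ∈ O,
      ‖iteratedFDerivWithin ℝ i g O q‖ ≤ C * (1 + ‖q‖) ^ N := by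
  obtain ⟨C, hC, N, h⟩ := hg.bound n
  refine ⟨C, hC, N, fun i hi q hq => ?_⟩
  rw [iteratedFDerivWithin_of_isOpen i hO hq]
  exact h i hi q hq

theorem SmoothPoly.growth (hg : SmoothPoly O g) :
    ∃ C : ℝ, 0 ≤ C ∧ ∃ N : ℕ, ∀ q ∈ O, |g q| ≤ C * (1 + ‖q‖) ^ N := by
  obtain ⟨C, hC, N, h⟩ := hg.bound 0
  refine ⟨C, by linarith, N, fun q hq => ?_⟩
  simpa using h 0 le_rfl q hq

theorem smoothPoly_const (hO : IsOpen O) (c : ℝ) : SmoothPoly O (fun _ => c) := by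
  refine SmoothPoly.of_bound hO contDiffOn_const fun n => ⟨|c|, 0, fun q hq => ?_⟩
  rw [iteratedFDerivWithin_of_isOpen n hO hq]
  rcases n with _ | n
  · simp
  · simp [iteratedFDeriv_const_of_ne (𝕜 := ℝ) (Nat.succ_ne_zero n) c]

theorem SmoothPoly.add (hO : IsOpen O) (hg : SmoothPoly O g) (hh : SmoothPoly O h) :
    SmoothPoly O (fun q => g q + h q) := by
  refine SmoothPoly.of_bound hO (hg.1.add hh.1) fun n => ?_
  obtain ⟨C, hC, N, h1⟩ := hg.boundWithin hO n
  obtain ⟨C', hC', N', h2⟩ := hh.boundWithin hO n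
  refine ⟨C + C', N + N', fun q hq => ?_⟩
  have hq1 : (1 : ℝ) ≤ 1 + ‖q‖ := by linarith [norm_nonneg q]
  have : iteratedFDerivWithin ℝ n (fun q => g q + h q) O q =
      iteratedFDerivWithin ℝ n g O q + iteratedFDerivWithin ℝ n h O q :=
    iteratedFDerivWithin_add_apply ((hg.1 q hq).of_le (by exact_mod_cast le_top))
      ((hh.1 q hq).of_le (by exact_mod_cast le_top)) hO.uniqueDiffOn hq
  rw [this, add_mul]
  refine (norm_add_le _ _).trans (add_le_add ?_ ?_)
  · refine (h1 n le_rfl q hq).trans ?_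
    gcongr; omega
  · refine (h2 n le_rfl q hq).trans ?_
    gcongr; omega

theorem SmoothPoly.mul (hO : IsOpen O) (hg : SmoothPoly O g) (hh : SmoothPoly O h) :
    SmoothPoly O (fun q => g q * h q) := by
  refine SmoothPoly.of_bound hO (hg.1.mul hh.1) fun n => ?_
  obtain ⟨C, hC, N, h1⟩ := hg.boundWithin hO n
  obtain ⟨C', hC', N', h2⟩ := hh.boundWithin hO n
  refine ⟨∑ i ∈ Finset.range (n + 1), (n.choose i : ℝ) * (C * C'), N + N', fun q hq => ?_⟩
  refine (norm_iteratedFDerivWithin_mul_le hg.1 hh.1 hO.uniqueDiffOn hq (n := n)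
    (by exact_mod_cast le_top)).trans ?_
  rw [Finset.sum_mul]
  refine Finset.sum_le_sum fun i hi => ?_
  have e1 := h1 i (by have := Finset.mem_range.1 hi; omega) q hq
  have e2 := h2 (n - i) (by omega) q hq
  calc _ ≤ (n.choose i : ℝ) * (C * (1 + ‖q‖) ^ N) * (C' * (1 + ‖q‖) ^ N') := by gcongr
    _ = _ := by rw [pow_add]; ring

theorem SmoothPoly.sum (hO : IsOpen O) {ι : Type*} (s : Finset ι) {g : ι → E m → ℝ}
    (hg : ∀ i ∈ s, SmoothPoly O (g i)) : SmoothPoly O (fun q => ∑ i ∈ s, g i q) := by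
  classical
  induction s using Finset.induction_on with
  | empty => simpa using smoothPoly_const hO 0
  | insert a s ha ih =>
    simp only [Finset.sum_insert ha]
    exact (hg a (by simp)).add hO (ih fun i hi => hg i (by simp [hi]))

theorem SmoothPoly.prod (hO : IsOpen O) {ι : Type*} (s : Finset ι) {g : ι → E m → ℝ}
    (hg : ∀ i ∈ s, SmoothPoly O (g i)) : SmoothPoly O (fun q => ∏ i ∈ s, g i q) := by
  classical
  induction s using Finset.induction_on with
  | empty => simpa using smoothPoly_const hO 1
  | insert a s ha ih =>
    simp only [Finset.prod_insert ha]
    exact (hg a (by simp)).mul hO (ih fun i hi => hg i (by simp [hi]))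

theorem SmoothPoly.pd (hO : IsOpen O) (hg : SmoothPoly O g) (k : Fin m) :
    SmoothPoly O (pd k g) := by
  have hfd : ContDiffOn ℝ ∞ (fderiv ℝ g) O := hg.1.fderiv_of_isOpen hO (by simp)
  have h0 : ContDiffOn ℝ ∞ (RMHMC.pd k g) O := hfd.clm_apply contDiffOn_const
  refine SmoothPoly.of_bound hO h0 fun n => ?_
  obtain ⟨C, hC, N, h1⟩ := hg.bound (n + 1)
  refine ⟨C, N, fun q hq => ?_⟩
  rw [iteratedFDerivWithin_of_isOpen n hO hq]
  have h2 := norm_iteratedFDeriv_clm_apply_const (c := EuclideanSpace.single k (1 : ℝ)) (n := n)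
    (hfd.contDiffAt (hO.mem_nhds hq)) (by exact_mod_cast le_top)
  refine h2.trans ?_
  rw [norm_iteratedFDeriv_fderiv]
  simpa using h1 (n + 1) le_rfl q hq

theorem abs_iteratedDeriv_log_le {c : ℝ} (hc : 0 < c) (n : ℕ) :
    ∃ C : ℝ, 0 ≤ C ∧ ∀ i ≤ n, 1 ≤ i → ∀ y, c ≤ y → |iteratedDeriv i Real.log y| ≤ C := by
  refine ⟨∑ i ∈ Finset.range n, (i.factorial : ℝ) * (c ^ (i + 1))⁻¹, by positivity, ?_⟩
  intro i hi hi1 y hy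
  obtain ⟨j, rfl⟩ := Nat.exists_eq_succ_of_ne_zero (by omega : i ≠ 0)
  have hy0 : 0 < y := hc.trans_le hy
  rw [Nat.succ_eq_add_one, iteratedDeriv_succ', Real.deriv_log', iteratedDeriv_eq_iterate]
  have h1 : |deriv^[j] Inv.inv y| ≤ (j.factorial : ℝ) * (c ^ (j + 1))⁻¹ := by
    rw [iter_deriv_inv, abs_mul, abs_mul, abs_pow, abs_neg, abs_one, one_pow, one_mul,
      Nat.abs_cast]
    gcongr
    rw [show (-1 - (j : ℤ)) = -((j + 1 : ℕ) : ℤ) by push_cast; ring, zpow_neg, zpow_natCast,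
      abs_of_pos (by positivity)]
    gcongr
  exact h1.trans (Finset.single_le_sum
    (f := fun i : ℕ => (i.factorial : ℝ) * (c ^ (i + 1))⁻¹) (fun i _ => by positivity)
    (Finset.mem_range.2 (by omega)))

/-- The logarithm of a function which is bounded away from zero: all derivatives of `log` are
bounded on `[c, ∞)`, so that the Faà di Bruno formula gives polynomial bounds. -/
theorem SmoothPoly.log (hO : IsOpen O) (hg : SmoothPoly O g) {c : ℝ} (hc : 0 < c)
    (hgc : ∀ q ∈ O, c ≤ g q) : SmoothPoly O (fun q => Real.log (g q)) := by
  have hpos : ∀ q ∈ O, g q ≠ 0 := fun q hq => (hc.trans_le (hgc q hq)).ne'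
  refine SmoothPoly.of_bound hO (hg.1.log hpos) fun n => ?_
  obtain ⟨C, hC, N, h1⟩ := hg.boundWithin hO n
  obtain ⟨L, hL, h2⟩ := abs_iteratedDeriv_log_le hc n
  refine ⟨n.factorial * (L + (|Real.log c| + C)) * C ^ n, N + N * n, fun q hq => ?_⟩
  have hq1 : (1 : ℝ) ≤ 1 + ‖q‖ := by linarith [norm_nonneg q]
  have hqN : (1 : ℝ) ≤ (1 + ‖q‖) ^ N := one_le_pow₀ hq1
  have hmaps : MapsTo g O (Ioi (c / 2)) := fun x hx => by
    have := hgc x hx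
    simp only [mem_Ioi]; linarith
  have hgq : 0 < g q := hc.trans_le (hgc q hq)
  have hlogb : |Real.log (g q)| ≤ |Real.log c| + C * (1 + ‖q‖) ^ N := by
    have h3 : g q ≤ C * (1 + ‖q‖) ^ N := by
      have := h1 0 (by omega) q hq
      simp only [norm_iteratedFDerivWithin_zero, Real.norm_eq_abs] at this
      exact (le_abs_self _).trans this
    have h4 := Real.log_le_sub_one_of_pos hgq
    have h5 := Real.log_le_log hc (hgc q hq)
    rw [abs_le]
    constructor
    · have := neg_abs_le (Real.log c)
      have : 0 ≤ C * (1 + ‖q‖) ^ N := by positivity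
      linarith
    · linarith [abs_nonneg (Real.log c)]
  have hcomp := norm_iteratedFDerivWithin_comp_le (𝕜 := ℝ) (g := Real.log) (f := g) (n := n)
    (s := O) (t := Ioi (c / 2)) (N := ∞) (x := q)
    (C := L + (|Real.log c| + C * (1 + ‖q‖) ^ N)) (D := C * (1 + ‖q‖) ^ N)
    (contDiffOn_id.log fun x hx => (lt_trans (by positivity) (mem_Ioi.1 hx)).ne') hg.1
    (by exact_mod_cast le_top) isOpen_Ioi.uniqueDiffOn hO.uniqueDiffOn hmaps hq
    (by
      intro i hi
      rw [norm_iteratedFDerivWithin_eq_norm_iteratedDerivWithin]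
      rw [iteratedDerivWithin_of_isOpen isOpen_Ioi (hmaps hq), Real.norm_eq_abs]
      rcases Nat.eq_zero_or_pos i with rfl | hi0
      · rw [iteratedDeriv_zero]
        linarith
      · have := h2 i hi hi0 (g q) (hgc q hq)
        have h6 : 0 ≤ |Real.log c| := abs_nonneg _
        have : 0 ≤ C * (1 + ‖q‖) ^ N := by positivity
        linarith)
    (by
      intro i hi hin
      refine (h1 i hin q hq).trans (le_self_pow₀ ?_ (by omega))
      nlinarith)
  refine hcomp.trans ?_
  rw [mul_pow, ← pow_mul, pow_add]
  have h7 : L + (|Real.log c| + C * (1 + ‖q‖) ^ N)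
      ≤ (L + (|Real.log c| + C)) * (1 + ‖q‖) ^ N := by
    have : 0 ≤ |Real.log c| := abs_nonneg _
    nlinarith
  calc _ ≤ n.factorial * ((L + (|Real.log c| + C)) * (1 + ‖q‖) ^ N)
        * (C ^ n * (1 + ‖q‖) ^ (N * n)) := by gcongr
    _ = _ := by ring

theorem SmoothPoly.hasFDerivAt (hg : SmoothPoly O g) (hO : IsOpen O) {q : E m} (hq : q ∈ O) :
    HasFDerivAt g (fderiv ℝ g q) q :=
  ((hg.contDiffAt hO hq).differentiableAt (by simp)).hasFDerivAt

theorem fderiv_eq_sum_pd (g : E m → ℝ) (q v : E m) : fderiv ℝ g q v = ∑ j, v j * pd j g q := by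
  conv_lhs => rw [← (EuclideanSpace.basisFun (Fin m) ℝ).sum_repr v]
  simp [pd, map_sum]

end SmoothPoly

/-! ### Taylor expansion along segments -/

/-- `jet k g q r` is the `k`-th derivative of `t ↦ g (q + t r)` at `t = 0`, written out with
partial derivatives. -/
noncomputable def jet {m : ℕ} : ℕ → (E m → ℝ) → E m → E m → ℝ
  | 0, g, q, _ => g q
  | k + 1, g, q, r => ∑ j, r j * jet k (pd j g) q r

section Taylor

variable {m : ℕ} {O : Set (E m)} {g : E m → ℝ}

theorem jet_neg (k : ℕ) (g : E m → ℝ) (q r : E m) : jet k g q (-r) = (-1) ^ k * jet k g q r := by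
  induction k generalizing g with
  | zero => simp [jet]
  | succ k ih =>
    simp only [jet, ih, Finset.mul_sum]
    refine Finset.sum_congr rfl fun j _ => ?_
    simp only [PiLp.neg_apply, pow_succ]; ring

theorem hasDerivAt_jet (hO : IsOpen O) (k : ℕ) (hg : SmoothPoly O g) (q r : E m) (t : ℝ)
    (ht : q + t • r ∈ O) :
    HasDerivAt (fun t : ℝ => jet k g (q + t • r) r) (jet (k + 1) g (q + t • r) r) t := by
  induction k generalizing g with
  | zero =>
    have h1 : HasDerivAt (fun t : ℝ => q + t • r) r t := by
      simpa using ((hasDerivAt_id t).smul_const r).const_add q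
    have := (hg.hasFDerivAt hO ht).comp_hasDerivAt t h1
    rw [fderiv_eq_sum_pd] at this
    exact this
  | succ k ih =>
    have := HasDerivAt.fun_sum (u := Finset.univ)
      fun j _ => (ih (hg.pd hO j)).const_mul (r j)
    exact this

theorem abs_apply_le_norm (v : E m) (j : Fin m) : |v j| ≤ ‖v‖ := by
  simpa using PiLp.norm_apply_le v j

theorem abs_jet_le (hO : IsOpen O) (k : ℕ) (hg : SmoothPoly O g) :
    ∃ C : ℝ, 0 ≤ C ∧ ∃ N : ℕ, ∀ q ∈ O, ∀ r, |jet k g q r| ≤ C * (1 + ‖q‖) ^ N * ‖r‖ ^ k := by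
  induction k generalizing g with
  | zero =>
    obtain ⟨C, hC, N, h⟩ := hg.growth
    exact ⟨C, hC, N, fun q hq r => by simpa [jet] using h q hq⟩
  | succ k ih =>
    choose C hC N h using fun j => ih (hg.pd hO j)
    refine ⟨∑ j, C j, Finset.sum_nonneg fun j _ => hC j, ∑ j, N j, fun q hq r => ?_⟩
    have hq1 : (1 : ℝ) ≤ 1 + ‖q‖ := by linarith [norm_nonneg q]
    rw [jet]
    refine (Finset.abs_sum_le_sum_abs _ _).trans ?_
    rw [Finset.sum_mul, Finset.sum_mul]
    refine Finset.sum_le_sum fun j _ => ?_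
    rw [abs_mul]
    have h1 : (1 + ‖q‖) ^ N j ≤ (1 + ‖q‖) ^ ∑ j, N j :=
      pow_le_pow_right₀ hq1 (Finset.single_le_sum (f := N) (fun _ _ => Nat.zero_le _)
        (Finset.mem_univ j))
    calc |r j| * |jet k (pd j g) q r| ≤ ‖r‖ * (C j * (1 + ‖q‖) ^ N j * ‖r‖ ^ k) := by
          gcongr
          · exact abs_apply_le_norm r j
          · exact h j q hq r
      _ ≤ ‖r‖ * (C j * (1 + ‖q‖) ^ (∑ j, N j) * ‖r‖ ^ k) := by
          gcongr
          exact hC j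
      _ = _ := by ring

/-- Taylor's formula in one variable for a chain of functions `F 0, F 1, …`, each of which is
the derivative of the preceding one. -/
theorem abs_taylor_le (n : ℕ) (F : ℕ → ℝ → ℝ) (M : ℝ)
    (hF : ∀ k, ∀ t ∈ Icc (0 : ℝ) 1, HasDerivAt (F k) (F (k + 1) t) t)
    (hM : ∀ t ∈ Icc (0 : ℝ) 1, |F n t| ≤ M) :
    ∀ t ∈ Icc (0 : ℝ) 1, |F 0 t - ∑ k ∈ Finset.range n, t ^ k / k.factorial * F k 0| ≤ M := by
  induction n generalizing F with
  | zero => simpa using hM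
  | succ n ih =>
    intro t ht
    have ih' := ih (fun k => F (k + 1)) (fun k => hF (k + 1)) hM
    let G : ℝ → ℝ := fun t => F 0 t - ∑ k ∈ Finset.range (n + 1), t ^ k / k.factorial * F k 0
    have hG : ∀ s ∈ Icc (0 : ℝ) 1, HasDerivAt G
        (F 1 s - ∑ k ∈ Finset.range n, s ^ k / k.factorial * F (k + 1) 0) s := by
      intro s hs
      have h2 : HasDerivAt
          (fun t : ℝ => ∑ k ∈ Finset.range (n + 1), t ^ k / k.factorial * F k 0)
          (∑ k ∈ Finset.range (n + 1), (k * s ^ (k - 1)) / k.factorial * F k 0) s :=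
        HasDerivAt.fun_sum fun k _ => ((hasDerivAt_pow k s).div_const _).mul_const _
      have h3 := (hF 0 s hs).sub h2
      rw [Finset.sum_range_succ'] at h3
      refine h3.congr_deriv ?_
      congr 1
      simp only [Nat.cast_zero, zero_mul, zero_div, add_zero, Nat.add_sub_cancel]
      refine Finset.sum_congr rfl fun k _ => ?_
      rw [Nat.factorial_succ]
      push_cast
      have : (k.factorial : ℝ) ≠ 0 := by positivity
      have : (k : ℝ) + 1 ≠ 0 := by positivity
      field_simp
    have hM0 : 0 ≤ M := (abs_nonneg _).trans (hM 0 (by simp))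
    have h4 := norm_image_sub_le_of_norm_deriv_le_segment' (f := G) (C := M) (a := 0) (b := 1)
      (fun s hs => (hG s hs).hasDerivWithinAt)
      (fun s hs => by simpa using ih' s ⟨hs.1, hs.2.le⟩) t ht
    have hG0 : G 0 = 0 := by
      simp only [G, Finset.sum_range_succ']
      simp
    rw [hG0, sub_zero, Real.norm_eq_abs] at h4
    refine h4.trans ?_
    nlinarith [ht.1, ht.2]

theorem abs_sub_jet_le (hO : IsOpen O) (hg : SmoothPoly O g) (n : ℕ) :
    ∃ C : ℝ, 0 ≤ C ∧ ∃ N : ℕ, ∀ q r : E m, (∀ t ∈ Icc (0 : ℝ) 1, q + t • r ∈ O) →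
      |g (q + r) - ∑ k ∈ Finset.range n, 1 / k.factorial * jet k g q r|
        ≤ C * (1 + ‖q‖ + ‖r‖) ^ N * ‖r‖ ^ n := by
  obtain ⟨C, hC, N, h⟩ := abs_jet_le hO n hg
  refine ⟨C, hC, N, fun q r hqr => ?_⟩
  have := abs_taylor_le n (fun k t => jet k g (q + t • r) r) (C * (1 + ‖q‖ + ‖r‖) ^ N * ‖r‖ ^ n)
    (fun k t ht => hasDerivAt_jet hO k hg q r t (hqr t ht))
    (fun t ht => by
      refine (h _ (hqr t ht) r).trans ?_
      have : ‖q + t • r‖ ≤ ‖q‖ + ‖r‖ := by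
        refine (norm_add_le _ _).trans ?_
        rw [norm_smul, Real.norm_eq_abs, abs_of_nonneg ht.1]
        gcongr
        exact mul_le_of_le_one_left (norm_nonneg r) ht.2
      rw [add_assoc]
      gcongr) 1 (by simp)
  simpa [jet] using this

end Taylor

/-! ### The diffusion matrix -/

section Matrix

variable {m : ℕ} {M : Matrix (Fin m) (Fin m) ℝ} {a b : ℝ}

theorem quad_eq_sum (M : Matrix (Fin m) (Fin m) ℝ) (v : Fin m → ℝ) :
    v ⬝ᵥ (M *ᵥ v) = ∑ i, ∑ j, M i j * v i * v j := by
  simp only [dotProduct, Matrix.mulVec, Finset.mul_sum]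
  exact Finset.sum_congr rfl fun i _ => Finset.sum_congr rfl fun j _ => by ring

theorem apply_comm_of_posDef (hM : M.PosDef) (i j : Fin m) : M i j = M j i := by
  simpa using (hM.isHermitian.apply i j).symm

theorem le_quad_of_posSemidef_sub (ha : (M - a • (1 : Matrix (Fin m) (Fin m) ℝ)).PosSemidef)
    (p : E m) : a * ‖p‖ ^ 2 ≤ p.ofLp ⬝ᵥ (M *ᵥ p.ofLp) := by
  have h := ha.dotProduct_mulVec_nonneg p.ofLp
  simp only [Matrix.sub_mulVec, Matrix.smul_mulVec, Matrix.one_mulVec, star_trivial,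
    dotProduct_sub, dotProduct_smul, smul_eq_mul] at h
  have : p.ofLp ⬝ᵥ p.ofLp = ‖p‖ ^ 2 := by
    rw [EuclideanSpace.real_norm_sq_eq, dotProduct]
    exact Finset.sum_congr rfl fun i _ => by ring
  rw [this] at h
  linarith

theorem abs_apply_le_of_posSemidef (hM : M.PosDef)
    (hb : (b • (1 : Matrix (Fin m) (Fin m) ℝ) - M).PosSemidef) (i j : Fin m) : |M i j| ≤ b := by
  have hd : ∀ i, M i i ≤ b := fun i => by
    have := hb.diag_nonneg (i := i)
    simp at this
    linarith
  have key : ∀ s : ℝ, 0 ≤ M i i + s * M i j + s * M j i + s * s * M j j := by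
    intro s
    have := hM.posSemidef.dotProduct_mulVec_nonneg (Pi.single i 1 + Pi.single j s)
    simp [Matrix.mulVec_add, add_dotProduct, dotProduct_add, Matrix.mulVec_single] at this
    linarith
  have h1 := key 1
  have h2 := key (-1)
  have := apply_comm_of_posDef hM i j
  rw [abs_le]
  constructor <;> linarith [hd i, hd j]

theorem pow_le_det_of_posSemidef_sub (hM : M.PosDef) (ha0 : 0 ≤ a)
    (ha : (M - a • (1 : Matrix (Fin m) (Fin m) ℝ)).PosSemidef) : a ^ m ≤ M.det := by
  rw [hM.isHermitian.det_eq_prod_eigenvalues]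
  have : ∀ i, a ≤ hM.isHermitian.eigenvalues i := by
    intro i
    rw [hM.isHermitian.eigenvalues_eq]
    have h := le_quad_of_posSemidef_sub ha (hM.isHermitian.eigenvectorBasis i)
    rw [(hM.isHermitian.eigenvectorBasis).norm_eq_one] at h
    simpa using h
  calc a ^ m = ∏ _i : Fin m, a := by simp
    _ ≤ _ := by
      simp only [RCLike.ofReal_real_eq_id, id]
      exact Finset.prod_le_prod (fun _ _ => ha0) fun i _ => this i

theorem abs_det_le (hM : ∀ i j, |M i j| ≤ b) : |M.det| ≤ m.factorial * b ^ m := by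
  have := Matrix.det_le (A := M) (abv := (AbsoluteValue.abs : AbsoluteValue ℝ ℝ)) (x := b) hM
  simpa using this

theorem norm_le_sum_abs (v : E m) : ‖v‖ ≤ ∑ i, |v i| := by
  rw [EuclideanSpace.norm_eq]
  refine Real.sqrt_le_iff.2 ⟨Finset.sum_nonneg fun i _ => abs_nonneg _, ?_⟩
  simp only [Real.norm_eq_abs]
  exact Finset.sum_sq_le_sq_sum_of_nonneg fun i _ => abs_nonneg _

theorem norm_mulVec_le (hM : ∀ i j, |M i j| ≤ b) (p : E m) :
    ‖(WithLp.toLp 2 (M *ᵥ p.ofLp) : E m)‖ ≤ (m * m * b) * ‖p‖ := by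
  refine (norm_le_sum_abs _).trans ?_
  have : ∀ i, |(M *ᵥ p.ofLp) i| ≤ m * b * ‖p‖ := by
    intro i
    rw [Matrix.mulVec, dotProduct]
    refine (Finset.abs_sum_le_sum_abs _ _).trans ?_
    calc ∑ j, |M i j * p.ofLp j| ≤ ∑ _j : Fin m, b * ‖p‖ := by
          refine Finset.sum_le_sum fun j _ => ?_
          rw [abs_mul]
          exact mul_le_mul (hM i j) (by simpa using PiLp.norm_apply_le p j) (abs_nonneg _)
            ((abs_nonneg _).trans (hM i j))
      _ = m * b * ‖p‖ := by simp; ring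
  calc ∑ i, |(M *ᵥ p.ofLp) i| ≤ ∑ _i : Fin m, m * b * ‖p‖ := Finset.sum_le_sum fun i _ => this i
    _ = _ := by simp; ring

theorem sqrt_mul_self_of_posDef (hM : M.PosDef) : CFC.sqrt M * CFC.sqrt M = M :=
  CFC.sqrt_mul_sqrt_self M (Matrix.nonneg_iff_posSemidef.2 hM.posSemidef)

theorem transpose_sqrt (M : Matrix (Fin m) (Fin m) ℝ) : (CFC.sqrt M)ᵀ = CFC.sqrt M := by
  have := (Matrix.nonneg_iff_posSemidef.1 (CFC.sqrt_nonneg M)).isHermitian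
  simpa [Matrix.IsHermitian, Matrix.conjTranspose_eq_transpose_of_trivial] using this

theorem isUnit_det_sqrt (hM : M.PosDef) : IsUnit (CFC.sqrt M).det := by
  have h : (CFC.sqrt M).det * (CFC.sqrt M).det = M.det := by
    rw [← Matrix.det_mul, sqrt_mul_self_of_posDef hM]
  refine isUnit_iff_ne_zero.2 fun h0 => hM.det_pos.ne' ?_
  rw [← h, h0, zero_mul]

theorem inv_sqrt_mul_transpose (hM : M.PosDef) :
    (CFC.sqrt M)⁻¹ * ((CFC.sqrt M)⁻¹)ᵀ = M⁻¹ := by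
  rw [Matrix.transpose_nonsing_inv, transpose_sqrt, ← Matrix.mul_inv_rev,
    sqrt_mul_self_of_posDef hM]

theorem quad_invSqrtMul (hM : M.PosDef) (g : E m) :
    (invSqrtMul M g).ofLp ⬝ᵥ (M *ᵥ (invSqrtMul M g).ofLp) = ‖g‖ ^ 2 := by
  have hu := isUnit_det_sqrt hM
  have h1 : (CFC.sqrt M)⁻¹ᵀ * (M * (CFC.sqrt M)⁻¹) = 1 := by
    rw [Matrix.transpose_nonsing_inv, transpose_sqrt]
    conv_lhs => rw [← sqrt_mul_self_of_posDef hM]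
    rw [sqrt_mul_self_of_posDef hM]
    nth_rewrite 2 [← sqrt_mul_self_of_posDef hM]
    rw [Matrix.mul_assoc, Matrix.mul_nonsing_inv _ hu, Matrix.mul_one, Matrix.nonsing_inv_mul _ hu]
  simp only [invSqrtMul]
  rw [Matrix.mulVec_mulVec, Matrix.dotProduct_mulVec, Matrix.vecMul_mulVec,
    ← Matrix.dotProduct_mulVec, h1, Matrix.one_mulVec, EuclideanSpace.real_norm_sq_eq, dotProduct]
  exact Finset.sum_congr rfl fun i _ => by ring

theorem norm_invSqrtMul_le (hM : M.PosDef) (ha0 : 0 < a)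
    (ha : (M - a • (1 : Matrix (Fin m) (Fin m) ℝ)).PosSemidef) (g : E m) :
    ‖invSqrtMul M g‖ ≤ (1 + a⁻¹) * ‖g‖ := by
  have h := le_quad_of_posSemidef_sub ha (invSqrtMul M g)
  rw [quad_invSqrtMul hM] at h
  have h1 : ‖invSqrtMul M g‖ ^ 2 ≤ a⁻¹ * ‖g‖ ^ 2 := by
    rw [inv_mul_eq_div, le_div_iff₀ ha0]; linarith
  have ha1 : 0 < a⁻¹ := by positivity
  refine abs_le_of_sq_le_sq' ?_ (by positivity) |>.2
  refine h1.trans ?_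
  rw [mul_pow]
  gcongr
  nlinarith

theorem invSqrtMul_neg (M : Matrix (Fin m) (Fin m) ℝ) (g : E m) :
    invSqrtMul M (-g) = -invSqrtMul M g := by
  ext i
  simp [invSqrtMul, Matrix.mulVec_neg]

theorem continuous_invSqrtMul (M : Matrix (Fin m) (Fin m) ℝ) : Continuous (invSqrtMul M) := by
  refine (PiLp.continuous_toLp 2 _).comp ?_
  exact Continuous.matrix_mulVec continuous_const (PiLp.continuous_ofLp 2 _)

end Matrix

/-- Jacobi's formula for the logarithm of a determinant. -/
theorem pd_log_det {m : ℕ} {n : ℕ} {D : E m → Matrix (Fin n) (Fin n) ℝ} {q : E m}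
    (hD : ∀ i j, DifferentiableAt ℝ (fun q => D q i j) q) (hdet : (D q).det ≠ 0) (k : Fin m) :
    pd k (fun q => Real.log (D q).det) q
      = ∑ i, ∑ j, (D q)⁻¹ j i * pd k (fun q => D q i j) q := by
  let F : ContinuousMultilinearMap ℝ (fun _ : Fin n => Fin n → ℝ) ℝ :=
    ⟨(Matrix.detRowAlternating (R := ℝ) (n := Fin n)).toMultilinearMap,
      Continuous.matrix_det (A := fun M : Matrix (Fin n) (Fin n) ℝ => M) continuous_id⟩
  have hF : ∀ A : Matrix (Fin n) (Fin n) ℝ, F A = A.det := fun A => rfl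
  let D' : E m → Fin n → Fin n → ℝ := fun q => D q
  have hD' : HasFDerivAt D' (fderiv ℝ D' q) q :=
    (differentiableAt_pi.2 fun i => differentiableAt_pi.2 fun j => hD i j).hasFDerivAt
  have hdD : ∀ v i j, fderiv ℝ D' q v i j = fderiv ℝ (fun q => D q i j) q v := by
    intro v i j
    have h1 := (hasFDerivAt_pi'.1 (hasFDerivAt_pi'.1 hD' i) j).fderiv
    rw [show (fun q => D q i j) = fun q => D' q i j from rfl, h1]
    rfl
  have h2 : HasFDerivAt (fun q => (D q).det) ((F.linearDeriv (D' q)).comp (fderiv ℝ D' q)) q :=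
    (F.hasFDerivAt (D' q)).comp q hD'
  have h3 := (h2.log hdet).fderiv
  rw [pd, h3]
  simp only [smul_apply, ContinuousLinearMap.comp_apply, smul_eq_mul,
    ContinuousMultilinearMap.linearDeriv_apply, Finset.mul_sum]
  refine Finset.sum_congr rfl fun i _ => ?_
  have h4 : ∀ w : Fin n → ℝ, F (Function.update (D' q) i w) = ∑ j, (D q).adjugate j i * w j := by
    intro w
    have : F (Function.update (D' q) i w) = ((D q).updateRow i w).det := rfl
    rw [this, ← Matrix.cramer_transpose_apply, Matrix.cramer_eq_adjugate_mulVec,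
      ← Matrix.adjugate_transpose, Matrix.mulVec, dotProduct]
    rfl
  rw [h4, Finset.mul_sum]
  refine Finset.sum_congr rfl fun j _ => ?_
  rw [hdD, Matrix.inv_def, Matrix.smul_apply, Ring.inverse_eq_inv', smul_eq_mul, pd]
  ring

/-! ### A calculus of remainders with polynomial weights -/

/-- A family of weights `w ≥ 1` and of time steps `h > 0`, the latter bounded above. -/
structure Scale (ι : Type*) where
  /-- the weight, in whose powers growth is measured -/
  w : ι → ℝ
  /-- the time step, in whose powers smallness is measured -/
  h : ι → ℝ
  one_le_w : ∀ i, 1 ≤ w i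
  h_pos : ∀ i, 0 < h i
  exists_h_le : ∃ H : ℝ, ∀ i, h i ≤ H

/-- `F = O(hᵏ)`, uniformly on the index type up to a power of the weight. -/
def PolyO {ι : Type*} (σ : Scale ι) (k : ℕ) (F : ι → ℝ) : Prop :=
  ∃ C : ℝ, 0 ≤ C ∧ ∃ N : ℕ, ∀ i, |F i| ≤ C * σ.w i ^ N * σ.h i ^ k

/-- `PolyO` for vector-valued families. -/
def PolyOVec {ι : Type*} {m : ℕ} (σ : Scale ι) (k : ℕ) (v : ι → E m) : Prop :=
  PolyO σ k fun i => ‖v i‖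

section PolyO

variable {ι : Type*} {σ : Scale ι} {k l : ℕ} {F G : ι → ℝ}

theorem PolyO.of_le (hF : PolyO σ k F) (h : ∀ i, |G i| ≤ |F i|) : PolyO σ k G := by
  obtain ⟨C, hC, N, hb⟩ := hF
  exact ⟨C, hC, N, fun i => (h i).trans (hb i)⟩

theorem PolyO.congr (hF : PolyO σ k F) (h : ∀ i, G i = F i) : PolyO σ k G :=
  hF.of_le fun i => by rw [h i]

theorem PolyO.add (hF : PolyO σ k F) (hG : PolyO σ k G) : PolyO σ k fun i => F i + G i := by
  obtain ⟨C, hC, N, h1⟩ := hF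
  obtain ⟨C', hC', N', h2⟩ := hG
  refine ⟨C + C', by positivity, N + N', fun i => ?_⟩
  have hw := σ.one_le_w i
  have hh := (σ.h_pos i).le
  refine (abs_add_le _ _).trans ?_
  rw [add_mul, add_mul]
  refine add_le_add ((h1 i).trans ?_) ((h2 i).trans ?_) <;> gcongr <;> first | assumption | omega

theorem PolyO.neg (hF : PolyO σ k F) : PolyO σ k fun i => -F i :=
  hF.of_le fun _ => by rw [abs_neg]

theorem PolyO.sub (hF : PolyO σ k F) (hG : PolyO σ k G) : PolyO σ k fun i => F i - G i :=
  (hF.add hG.neg).congr fun _ => sub_eq_add_neg _ _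

theorem PolyO.mul (hF : PolyO σ k F) (hG : PolyO σ l G) :
    PolyO σ (k + l) fun i => F i * G i := by
  obtain ⟨C, hC, N, h1⟩ := hF
  obtain ⟨C', hC', N', h2⟩ := hG
  refine ⟨C * C', by positivity, N + N', fun i => ?_⟩
  have hw := σ.one_le_w i
  have hh := (σ.h_pos i).le
  rw [abs_mul]
  calc |F i| * |G i| ≤ (C * σ.w i ^ N * σ.h i ^ k) * (C' * σ.w i ^ N' * σ.h i ^ l) :=
        mul_le_mul (h1 i) (h2 i) (abs_nonneg _) (by positivity)
    _ = _ := by rw [pow_add, pow_add]; ring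

theorem PolyO.weaken (hF : PolyO σ l F) (hkl : k ≤ l) : PolyO σ k F := by
  obtain ⟨C, hC, N, h1⟩ := hF
  obtain ⟨H, hH⟩ := σ.exists_h_le
  refine ⟨C * |H| ^ (l - k), by positivity, N, fun i => (h1 i).trans ?_⟩
  have hw := σ.one_le_w i
  have hh := (σ.h_pos i).le
  have h2 : σ.h i ^ l = σ.h i ^ (l - k) * σ.h i ^ k := by rw [← pow_add]; congr 1; omega
  have h3 : σ.h i ^ (l - k) ≤ |H| ^ (l - k) := by
    gcongr
    exact (hH i).trans (le_abs_self H)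
  rw [h2]
  calc C * σ.w i ^ N * (σ.h i ^ (l - k) * σ.h i ^ k)
      ≤ C * σ.w i ^ N * (|H| ^ (l - k) * σ.h i ^ k) := by gcongr
    _ = _ := by ring

theorem polyO_const (σ : Scale ι) (c : ℝ) : PolyO σ 0 fun _ => c :=
  ⟨|c|, abs_nonneg c, 0, fun i => by simp⟩

theorem polyO_h (σ : Scale ι) : PolyO σ 1 σ.h :=
  ⟨1, zero_le_one, 0, fun i => by simp [abs_of_pos (σ.h_pos i)]⟩

theorem polyO_w (σ : Scale ι) : PolyO σ 0 σ.w :=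
  ⟨1, zero_le_one, 1, fun i => by simp [abs_of_pos (zero_lt_one.trans_le (σ.one_le_w i))]⟩

theorem PolyO.const_mul (hF : PolyO σ k F) (c : ℝ) : PolyO σ k fun i => c * F i := by
  simpa using (polyO_const σ c).mul hF

theorem PolyO.h_mul (hF : PolyO σ k F) : PolyO σ (k + 1) fun i => σ.h i * F i := by
  simpa [add_comm] using (polyO_h σ).mul hF

theorem PolyO.sum {α : Type*} (s : Finset α) {F : α → ι → ℝ} (hF : ∀ a ∈ s, PolyO σ k (F a)) :
    PolyO σ k fun i => ∑ a ∈ s, F a i := by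
  classical
  induction s using Finset.induction_on with
  | empty =>
    simp only [Finset.sum_empty]
    exact ⟨0, le_rfl, 0, fun i => by simp⟩
  | insert a s ha ih =>
    simp only [Finset.sum_insert ha]
    exact (hF a (by simp)).add (ih fun b hb => hF b (by simp [hb]))

theorem PolyO.pow (hF : PolyO σ 0 F) (n : ℕ) : PolyO σ 0 fun i => F i ^ n := by
  induction n with
  | zero => simpa using polyO_const σ 1
  | succ n ih => simpa [pow_succ] using ih.mul hF

theorem PolyO.abs (hF : PolyO σ k F) : PolyO σ k fun i => |F i| :=
  hF.of_le fun i => by rw [abs_abs]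

/-- Non-negative real powers of bounded families are bounded. -/
theorem PolyO.rpow (hF : PolyO σ 0 F) (h0 : ∀ i, 0 ≤ F i) {δ : ℝ} (hδ : 0 ≤ δ) :
    PolyO σ 0 fun i => F i ^ δ := by
  refine (((polyO_const σ 1).add hF).pow ⌈δ⌉₊).of_le fun i => ?_
  have h1 : F i ^ δ ≤ (1 + F i) ^ δ := Real.rpow_le_rpow (h0 i) (by linarith) hδ
  have h2 : (1 + F i) ^ δ ≤ (1 + F i) ^ ((⌈δ⌉₊ : ℕ) : ℝ) :=
    Real.rpow_le_rpow_of_exponent_le (by linarith [h0 i]) (Nat.le_ceil δ)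
  rw [Real.rpow_natCast] at h2
  rw [abs_of_nonneg (Real.rpow_nonneg (h0 i) δ)]
  exact (h1.trans h2).trans (le_abs_self _)

theorem PolyO.pullback {κ : Type*} (hF : PolyO σ k F) (τ : Scale κ) (φ : κ → ι)
    (hw : ∀ i, σ.w (φ i) = τ.w i) (hh : ∀ i, σ.h (φ i) = τ.h i) :
    PolyO τ k fun i => F (φ i) := by
  obtain ⟨C, hC, N, h⟩ := hF
  exact ⟨C, hC, N, fun i => by simpa [hw, hh] using h (φ i)⟩

variable {m : ℕ} {u v : ι → E m}

theorem PolyOVec.apply (hv : PolyOVec σ k v) (j : Fin m) : PolyO σ k fun i => v i j :=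
  PolyO.of_le hv fun i => (abs_apply_le_norm (v i) j).trans (le_abs_self _)

theorem PolyOVec.of_apply (hv : ∀ j, PolyO σ k fun i => v i j) : PolyOVec σ k v :=
  (PolyO.sum Finset.univ fun j _ => (hv j).abs).of_le fun i => by
    rw [abs_of_nonneg (norm_nonneg _)]
    exact (norm_le_sum_abs _).trans (le_abs_self _)

theorem PolyOVec.congr (hv : PolyOVec σ k v) (h : ∀ i, u i = v i) : PolyOVec σ k u :=
  PolyO.congr hv fun i => by rw [h i]

theorem PolyOVec.add (hu : PolyOVec σ k u) (hv : PolyOVec σ k v) :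
    PolyOVec σ k fun i => u i + v i :=
  (PolyO.add hu hv).of_le fun i => by
    rw [abs_of_nonneg (norm_nonneg _)]
    exact (norm_add_le _ _).trans (le_abs_self _)

theorem PolyOVec.neg (hu : PolyOVec σ k u) : PolyOVec σ k fun i => -u i :=
  PolyO.congr hu fun i => by rw [norm_neg]

theorem PolyOVec.sub (hu : PolyOVec σ k u) (hv : PolyOVec σ k v) :
    PolyOVec σ k fun i => u i - v i :=
  (hu.add hv.neg).congr fun _ => sub_eq_add_neg _ _

theorem PolyOVec.const_smul (hu : PolyOVec σ k u) (c : ℝ) : PolyOVec σ k fun i => c • u i :=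
  (PolyO.const_mul hu ‖c‖).congr fun i => by rw [norm_smul]

theorem PolyOVec.weaken (hu : PolyOVec σ l u) (hkl : k ≤ l) : PolyOVec σ k u :=
  PolyO.weaken hu hkl

/-! ### Taylor expansion with polynomially weighted remainders -/

variable {O : Set (E m)} {g : E m → ℝ}

theorem SmoothPoly.polyO_comp (hg : SmoothPoly O g) (hu : PolyOVec σ 0 u) (huO : ∀ i, u i ∈ O) :
    PolyO σ 0 fun i => g (u i) := by
  obtain ⟨C, hC, N, h⟩ := hg.growth
  refine ((((polyO_const σ 1).add hu).pow N).const_mul C).of_le fun i => ?_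
  exact (h _ (huO i)).trans (le_abs_self _)

theorem SmoothPoly.polyO_taylor (hO : IsOpen O) (hconv : Convex ℝ O) (hg : SmoothPoly O g)
    (n : ℕ) (hu : PolyOVec σ 0 u) (huO : ∀ i, u i ∈ O) (hv : PolyOVec σ k v)
    (hvO : ∀ i, u i + v i ∈ O) :
    PolyO σ (n * k) fun i =>
      g (u i + v i) - ∑ l ∈ Finset.range n, 1 / l.factorial * jet l g (u i) (v i) := by
  obtain ⟨C, hC, N, h⟩ := abs_sub_jet_le hO hg n
  have h1 : PolyO σ (n * k) fun i => ‖v i‖ ^ n := by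
    clear h
    induction n with
    | zero => simpa using polyO_const σ 1
    | succ n ih => simpa [pow_succ, Nat.add_mul] using ih.mul hv
  have hv0 : PolyOVec σ 0 v := hv.weaken (Nat.zero_le _)
  have h2 := (((((polyO_const σ 1).add hu).add hv0).pow N).const_mul C).mul h1
  rw [zero_add] at h2
  refine h2.of_le fun i => (h _ _ ?_).trans (le_abs_self _)
  intro t ht
  have := hconv.add_smul_sub_mem (huO i) (hvO i) ht
  simpa using this

theorem SmoothPoly.polyO_sub (hO : IsOpen O) (hconv : Convex ℝ O) (hg : SmoothPoly O g)
    (hu : PolyOVec σ 0 u) (huO : ∀ i, u i ∈ O) (hvO : ∀ i, v i ∈ O)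
    (hv : PolyOVec σ k fun i => v i - u i) : PolyO σ k fun i => g (v i) - g (u i) := by
  have := hg.polyO_taylor hO hconv 1 hu huO hv (fun i => by simpa using hvO i)
  rw [one_mul] at this
  exact this.congr fun i => by simp [jet]

theorem PolyO.sum_mul {p : ι → Fin m → ℝ} (hv : PolyOVec σ k v)
    (hp : ∀ j, PolyO σ l fun i => p i j) : PolyO σ (k + l) fun i => ∑ j, v i j * p i j :=
  PolyO.sum Finset.univ fun j _ => (hv.apply j).mul (hp j)

/-- Two families of points which are symmetric around `q` up to `O(h²)`. -/
structure SymmPair (σ : Scale ι) (q u v : ι → E m) (O : Set (E m)) : Prop where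
  base : PolyOVec σ 0 q
  base_mem : ∀ i, q i ∈ O
  left_mem : ∀ i, u i ∈ O
  right_mem : ∀ i, v i ∈ O
  left : PolyOVec σ 1 fun i => u i - q i
  right : PolyOVec σ 1 fun i => v i - q i
  symm : PolyOVec σ 2 fun i => u i + v i - (2 : ℝ) • q i

variable {q : ι → E m}

/-- The midpoint of a symmetric pair. -/
theorem SymmPair.mid (hconv : Convex ℝ O) (hp : SymmPair σ q u v O) :
    (∀ i, (1 / 2 : ℝ) • (u i + v i) ∈ O) ∧
    PolyOVec σ 2 (fun i => (1 / 2 : ℝ) • (u i + v i) - q i) ∧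
    PolyOVec σ 0 (fun i => (1 / 2 : ℝ) • (u i + v i)) := by
  have h2 : PolyOVec σ 2 (fun i => (1 / 2 : ℝ) • (u i + v i) - q i) :=
    (hp.symm.const_smul (1 / 2)).congr fun i => by module
  refine ⟨fun i => ?_, h2, ?_⟩
  · have := hconv (hp.left_mem i) (hp.right_mem i) (a := 1 / 2) (b := 1 / 2)
      (by norm_num) (by norm_num) (by norm_num)
    rwa [← smul_add] at this
  · exact ((h2.weaken (Nat.zero_le _)).add hp.base).congr fun i => by module

theorem SymmPair.half_sub (hp : SymmPair σ q u v O) :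
    PolyOVec σ 1 (fun i => (1 / 2 : ℝ) • (u i - v i)) :=
  ((hp.left.sub hp.right).const_smul (1 / 2)).congr fun i => by module

/-- Even part of `g` on a symmetric pair, to order four. -/
theorem SymmPair.polyO_even (hO : IsOpen O) (hconv : Convex ℝ O) (hp : SymmPair σ q u v O)
    (hg : SmoothPoly O g) :
    PolyO σ 4 fun i => 1 / 2 * (g (u i) + g (v i)) - g (q i)
      - jet 1 g (q i) ((1 / 2 : ℝ) • (u i + v i) - q i)
      - 1 / 2 * jet 2 g (q i) ((1 / 2 : ℝ) • (u i - v i)) := by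
  obtain ⟨hmO, hmq, hm0⟩ := hp.mid hconv
  have hr := hp.half_sub
  have e1 : ∀ i, (1 / 2 : ℝ) • (u i + v i) + (1 / 2 : ℝ) • (u i - v i) = u i := fun i => by module
  have e2 : ∀ i, (1 / 2 : ℝ) • (u i + v i) + -((1 / 2 : ℝ) • (u i - v i)) = v i :=
    fun i => by module
  have e3 : ∀ i, q i + ((1 / 2 : ℝ) • (u i + v i) - q i) = (1 / 2 : ℝ) • (u i + v i) :=
    fun i => by module
  have t1 := hg.polyO_taylor hO hconv 4 hm0 hmO hr (fun i => by rw [e1]; exact hp.left_mem i)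
  have t2 := hg.polyO_taylor hO hconv 4 hm0 hmO hr.neg
    (fun i => by rw [e2]; exact hp.right_mem i)
  have t3 := hg.polyO_taylor hO hconv 2 hp.base hp.base_mem hmq
    (fun i => by rw [e3]; exact hmO i)
  -- the second-order coefficient may be moved from the midpoint to `q`
  have t4 : PolyO σ 4 fun i => jet 2 g ((1 / 2 : ℝ) • (u i + v i)) ((1 / 2 : ℝ) • (u i - v i))
      - jet 2 g (q i) ((1 / 2 : ℝ) • (u i - v i)) := by
    have h2 : ∀ j k, PolyO σ 2 fun i => pd k (pd j g) ((1 / 2 : ℝ) • (u i + v i))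
        - pd k (pd j g) (q i) := fun j k =>
      ((hg.pd hO j).pd hO k).polyO_sub hO hconv hp.base hp.base_mem hmO hmq
    have h3 := PolyO.sum_mul hr fun j => PolyO.sum_mul hr fun k => h2 j k
    refine h3.congr fun i => ?_
    simp only [jet, ← Finset.sum_sub_distrib, ← mul_sub]
  have := (((t1.add t2).const_mul (1 / 2)).add t3).add (t4.const_mul (1 / 2))
  refine this.congr fun i => ?_
  simp only [e1, e2, e3, jet_neg, Finset.sum_range_succ, Finset.sum_range_zero]
  simp only [jet, Nat.factorial]
  push_cast
  ring

/-- Odd part of `g` on a symmetric pair, to order three. -/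
theorem SymmPair.polyO_odd (hO : IsOpen O) (hconv : Convex ℝ O) (hp : SymmPair σ q u v O)
    (hg : SmoothPoly O g) :
    PolyO σ 3 fun i => g (u i) - g (v i) - ∑ j, (u i - v i) j * pd j g (q i) := by
  obtain ⟨hmO, hmq, hm0⟩ := hp.mid hconv
  have hr := hp.half_sub
  have e1 : ∀ i, (1 / 2 : ℝ) • (u i + v i) + (1 / 2 : ℝ) • (u i - v i) = u i := fun i => by module
  have e2 : ∀ i, (1 / 2 : ℝ) • (u i + v i) + -((1 / 2 : ℝ) • (u i - v i)) = v i :=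
    fun i => by module
  have t1 := hg.polyO_taylor hO hconv 3 hm0 hmO hr (fun i => by rw [e1]; exact hp.left_mem i)
  have t2 := hg.polyO_taylor hO hconv 3 hm0 hmO hr.neg
    (fun i => by rw [e2]; exact hp.right_mem i)
  have t4 := PolyO.sum_mul hr fun j =>
    (hg.pd hO j).polyO_sub hO hconv hp.base hp.base_mem hmO hmq
  have := (t1.sub t2).add (t4.const_mul 2)
  refine this.congr fun i => ?_
  have h5 : ∑ j, (u i - v i) j * pd j g (q i)
      = 2 * ∑ j, ((1 / 2 : ℝ) • (u i - v i)) j * pd j g (q i) := by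
    rw [Finset.mul_sum]
    refine Finset.sum_congr rfl fun j _ => ?_
    simp only [PiLp.smul_apply, smul_eq_mul]; ring
  simp only [e1, e2, jet_neg, Finset.sum_range_succ, Finset.sum_range_zero, h5, mul_sub,
    Finset.sum_sub_distrib]
  simp only [jet, Nat.factorial]
  push_cast
  ring

/-- Two scalar families which are symmetric around `c` up to `O(h²)`. -/
structure SymmVal (σ : Scale ι) (c F G : ι → ℝ) : Prop where
  base : PolyO σ 0 c
  left : PolyO σ 1 fun i => F i - c i
  right : PolyO σ 1 fun i => G i - c i
  symm : PolyO σ 2 fun i => F i + G i - 2 * c i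

variable {c c' F' G' : ι → ℝ}

theorem SymmVal.add (h1 : SymmVal σ c F G) (h2 : SymmVal σ c' F' G') :
    SymmVal σ (fun i => c i + c' i) (fun i => F i + F' i) (fun i => G i + G' i) where
  base := h1.base.add h2.base
  left := (h1.left.add h2.left).congr fun i => by ring
  right := (h1.right.add h2.right).congr fun i => by ring
  symm := (h1.symm.add h2.symm).congr fun i => by ring

theorem SymmVal.mul (h1 : SymmVal σ c F G) (h2 : SymmVal σ c' F' G') :
    SymmVal σ (fun i => c i * c' i) (fun i => F i * F' i) (fun i => G i * G' i) where
  base := h1.base.mul h2.base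
  left := (((h1.left.mul (h2.left)).weaken (by norm_num)).add
    ((h1.base.mul h2.left).add (h1.left.mul h2.base))).congr fun i => by ring
  right := (((h1.right.mul (h2.right)).weaken (by norm_num)).add
    ((h1.base.mul h2.right).add (h1.right.mul h2.base))).congr fun i => by ring
  symm := (((h1.left.mul h2.left).add (h1.right.mul h2.right)).add
    ((h1.base.mul h2.symm).add (h1.symm.mul h2.base))).congr fun i => by ring

theorem symmVal_const (σ : Scale ι) (c : ℝ) :
    SymmVal σ (fun _ => c) (fun _ => c) (fun _ => c) := by
  have h0 : PolyO σ 2 fun _ => (0 : ℝ) := ⟨0, le_rfl, 0, fun i => by simp⟩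
  exact ⟨polyO_const σ c, (h0.weaken (by norm_num)).congr fun i => by ring,
    (h0.weaken (by norm_num)).congr fun i => by ring, h0.congr fun i => by ring⟩

theorem SymmVal.sum {α : Type*} (s : Finset α) {c F G : α → ι → ℝ}
    (h : ∀ a ∈ s, SymmVal σ (c a) (F a) (G a)) :
    SymmVal σ (fun i => ∑ a ∈ s, c a i) (fun i => ∑ a ∈ s, F a i) (fun i => ∑ a ∈ s, G a i) := by
  classical
  induction s using Finset.induction_on with
  | empty => simpa using symmVal_const σ 0
  | insert a s ha ih =>
    simp only [Finset.sum_insert ha]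
    exact (h a (by simp)).add (ih fun b hb => h b (by simp [hb]))

theorem SymmVal.polyO_left (h : SymmVal σ c F G) : PolyO σ 0 F :=
  ((h.left.weaken (Nat.zero_le _)).add h.base).congr fun i => by ring

theorem SymmVal.polyO_right (h : SymmVal σ c F G) : PolyO σ 0 G :=
  ((h.right.weaken (Nat.zero_le _)).add h.base).congr fun i => by ring

theorem SymmPair.comp (hO : IsOpen O) (hconv : Convex ℝ O) (hp : SymmPair σ q u v O)
    (hg : SmoothPoly O g) :
    SymmVal σ (fun i => g (q i)) (fun i => g (u i)) (fun i => g (v i)) where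
  base := hg.polyO_comp hp.base hp.base_mem
  left := hg.polyO_sub hO hconv hp.base hp.base_mem hp.left_mem hp.left
  right := hg.polyO_sub hO hconv hp.base hp.base_mem hp.right_mem hp.right
  symm := by
    have e1 : ∀ i, q i + (u i - q i) = u i := fun i => by module
    have e2 : ∀ i, q i + (v i - q i) = v i := fun i => by module
    have t1 := hg.polyO_taylor hO hconv 2 hp.base hp.base_mem hp.left
      (fun i => by rw [e1]; exact hp.left_mem i)
    have t2 := hg.polyO_taylor hO hconv 2 hp.base hp.base_mem hp.right
      (fun i => by rw [e2]; exact hp.right_mem i)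
    have t3 := PolyO.sum_mul hp.symm fun j => (hg.pd hO j).polyO_comp hp.base hp.base_mem
    refine ((t1.add t2).add t3).congr fun i => ?_
    have h5 : ∑ j, (u i + v i - (2 : ℝ) • q i) j * pd j g (q i)
        = ∑ j, (u i - q i) j * pd j g (q i) + ∑ j, (v i - q i) j * pd j g (q i) := by
      rw [← Finset.sum_add_distrib]
      refine Finset.sum_congr rfl fun j _ => ?_
      simp only [PiLp.smul_apply, PiLp.add_apply, PiLp.sub_apply, smul_eq_mul]; ring
    simp only [e1, e2, h5, Finset.sum_range_succ, Finset.sum_range_zero, jet, Nat.factorial]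
    push_cast
    ring

end PolyO

/-! ### The Hamiltonian and its gradients -/

section Hamiltonian

variable {m : ℕ} {O : Set (E m)} {V : E m → ℝ} {D : E m → Matrix (Fin m) (Fin m) ℝ} {a b c : ℝ}

/-- The part `V - ½ ln det D` of the Hamiltonian which does not depend on the momentum. -/
noncomputable def pot (V : E m → ℝ) (D : E m → Matrix (Fin m) (Fin m) ℝ) (q : E m) : ℝ :=
  V q - 1 / 2 * Real.log (D q).det

/-- The partial derivative `∂H/∂q_k`, written out. -/
noncomputable def force (V : E m → ℝ) (D : E m → Matrix (Fin m) (Fin m) ℝ) (k : Fin m)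
    (q p : E m) : ℝ :=
  pd k (pot V D) q + 1 / 2 * ∑ i, ∑ j, pd k (fun q => D q i j) q * p i * p j

theorem force_neg (k : Fin m) (q p : E m) : force V D k q (-p) = force V D k q p := by
  simp [force]

theorem Admissible.det_smooth (hO : IsOpen O) (hVD : Admissible O V D a b c) :
    SmoothPoly O (fun q => (D q).det) := by
  simp only [Matrix.det_apply']
  exact SmoothPoly.sum hO _ fun τ _ => (smoothPoly_const hO _).mul hO
    (SmoothPoly.prod hO _ fun i _ => hVD.D_smooth (τ i) i)

theorem Admissible.pow_le_det (hVD : Admissible O V D a b c) {q : E m} (hq : q ∈ O) :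
    a ^ m ≤ (D q).det :=
  pow_le_det_of_posSemidef_sub (hVD.posDef q hq) hVD.a_pos.le (hVD.lower q hq)

theorem Admissible.log_det_smooth (hO : IsOpen O) (hVD : Admissible O V D a b c) :
    SmoothPoly O (fun q => Real.log (D q).det) :=
  (hVD.det_smooth hO).log hO (pow_pos hVD.a_pos m) fun _ hq => hVD.pow_le_det hq

theorem Admissible.pot_smooth (hO : IsOpen O) (hVD : Admissible O V D a b c) :
    SmoothPoly O (pot V D) := by
  have := hVD.V_smooth.add hO ((smoothPoly_const hO (-(1 / 2))).mul hO (hVD.log_det_smooth hO))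
  have e : pot V D = fun q => V q + -(1 / 2) * Real.log (D q).det := by
    ext q; simp only [pot]; ring
  rwa [e]

theorem Admissible.abs_D_le (hVD : Admissible O V D a b c) {q : E m} (hq : q ∈ O) (i j : Fin m) :
    |D q i j| ≤ b :=
  abs_apply_le_of_posSemidef (hVD.posDef q hq) (hVD.upper q hq) i j

/-- `H` controls the momentum: `V` is bounded below and `det D` is bounded above. -/
theorem Admissible.exists_norm_sq_le (hVD : Admissible O V D a b c) :
    ∃ L : ℝ, ∀ x ∈ conf O, a / 2 * ‖x.2‖ ^ 2 ≤ ham V D x + L := by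
  refine ⟨m.factorial * b ^ m - c, fun x hx => ?_⟩
  have hx' : x.1 ∈ O := hx
  have h1 := hVD.V_ge _ hx'
  have h2 := le_quad_of_posSemidef_sub (hVD.lower _ hx') x.2
  have hdet := (hVD.posDef _ hx').det_pos
  have h3 := Real.log_le_sub_one_of_pos hdet
  have h4 := (le_abs_self _).trans (abs_det_le (hVD.abs_D_le hx'))
  have h5 : 0 < m.factorial * b ^ m := hdet.trans_le h4
  simp only [ham]
  linarith

theorem ham_eq (x : X m) :
    ham V D x = pot V D x.1 + 1 / 2 * ∑ i, ∑ j, D x.1 i j * x.2 i * x.2 j := by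
  simp only [ham, pot, quad_eq_sum]

theorem gradient_apply (g : E m → ℝ) (q : E m) (k : Fin m) : gradient g q k = pd k g q := by
  have h : inner ℝ (gradient g q) (EuclideanSpace.single k (1 : ℝ)) = pd k g q := by
    rw [gradient, InnerProductSpace.toDual_symm_apply, pd]
  rw [← h, EuclideanSpace.inner_single_right]
  simp

theorem hasFDerivAt_coord (i : Fin m) (p : E m) :
    HasFDerivAt (fun p : E m => p i) (EuclideanSpace.proj i : E m →L[ℝ] ℝ) p :=
  (EuclideanSpace.proj i : E m →L[ℝ] ℝ).hasFDerivAt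

theorem gradP_ham_apply (hVD : Admissible O V D a b c) {x : X m} (hx : x.1 ∈ O) (k : Fin m) :
    gradP (ham V D) x k = ∑ j, D x.1 k j * x.2 j := by
  rw [gradP, gradient_apply, pd]
  simp only [ham_eq]
  have h : HasFDerivAt (fun p : E m => pot V D x.1 + 1 / 2 * ∑ i, ∑ j, D x.1 i j * p i * p j) _
      x.2 := HasFDerivAt.const_add _ (HasFDerivAt.const_mul (HasFDerivAt.fun_sum (u := Finset.univ)
        fun i _ => HasFDerivAt.fun_sum (u := Finset.univ) fun j _ =>
        ((hasFDerivAt_coord i x.2).const_mul (D x.1 i j)).mul (hasFDerivAt_coord j x.2)) (1 / 2))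
  rw [h.fderiv]
  simp [Finset.sum_add_distrib]
  have : ∀ i, D x.1 i k = D x.1 k i := fun i => apply_comm_of_posDef (hVD.posDef _ hx) _ _
  simp only [this, mul_comm (x.2.ofLp _)]
  ring

theorem gradQ_ham_apply (hO : IsOpen O) (hVD : Admissible O V D a b c) {x : X m} (hx : x.1 ∈ O)
    (k : Fin m) : gradQ (ham V D) x k = force V D k x.1 x.2 := by
  rw [gradQ, gradient_apply, pd]
  simp only [ham_eq]
  have h : HasFDerivAt (fun q : E m => pot V D q + 1 / 2 * ∑ i, ∑ j, D q i j * x.2 i * x.2 j) _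
      x.1 := HasFDerivAt.add ((hVD.pot_smooth hO).hasFDerivAt hO hx)
        (HasFDerivAt.const_mul (HasFDerivAt.fun_sum (u := Finset.univ)
        fun i _ => HasFDerivAt.fun_sum (u := Finset.univ) fun j _ =>
        (((hVD.D_smooth i j).hasFDerivAt hO hx).mul_const (x.2 i)).mul_const (x.2 j)) (1 / 2))
  rw [h.fderiv]
  simp only [force, pd, add_apply, smul_apply, sum_apply, smul_eq_mul]
  congr 2
  exact Finset.sum_congr rfl fun i _ => Finset.sum_congr rfl fun j _ => by ring

end Hamiltonian

/-! ### Expansion of the two schemes -/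

/-- `F = c + O(h)` with `c` bounded. -/
structure NearVal {ι : Type*} (σ : Scale ι) (c F : ι → ℝ) : Prop where
  base : PolyO σ 0 c
  near : PolyO σ 1 fun i => F i - c i

section NearVal

variable {ι : Type*} {σ : Scale ι} {c F c' F' : ι → ℝ}

theorem NearVal.add (h1 : NearVal σ c F) (h2 : NearVal σ c' F') :
    NearVal σ (fun i => c i + c' i) (fun i => F i + F' i) where
  base := h1.base.add h2.base
  near := (h1.near.add h2.near).congr fun i => by ring

theorem NearVal.mul (h1 : NearVal σ c F) (h2 : NearVal σ c' F') :
    NearVal σ (fun i => c i * c' i) (fun i => F i * F' i) where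
  base := h1.base.mul h2.base
  near := (((h1.near.mul (h2.near)).weaken (by norm_num)).add
    ((h1.base.mul h2.near).add (h1.near.mul h2.base))).congr fun i => by ring

theorem nearVal_const (σ : Scale ι) (c : ℝ) : NearVal σ (fun _ => c) (fun _ => c) where
  base := polyO_const σ c
  near := ⟨0, le_rfl, 0, fun i => by simp⟩

theorem NearVal.sum {α : Type*} (s : Finset α) {c F : α → ι → ℝ}
    (h : ∀ a ∈ s, NearVal σ (c a) (F a)) :
    NearVal σ (fun i => ∑ a ∈ s, c a i) (fun i => ∑ a ∈ s, F a i) where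
  base := PolyO.sum s fun a ha => (h a ha).base
  near := (PolyO.sum s fun a ha => (h a ha).near).congr fun i => by rw [Finset.sum_sub_distrib]

end NearVal

section Scheme

variable {m : ℕ} {O : Set (E m)} {V : E m → ℝ} {D : E m → Matrix (Fin m) (Fin m) ℝ} {a b c : ℝ}

/-- The position at which the force is evaluated in a step from `q` to `u`. -/
noncomputable def forcePoint (s : Scheme) (q u : E m) : E m :=
  match s with
  | .imr => (1 / 2 : ℝ) • (q + u)
  | .gsv => q

/-- The matrix which maps the intermediate momentum to the velocity in a step from `q` to `u`. -/
noncomputable def stepMatrix (s : Scheme) (D : E m → Matrix (Fin m) (Fin m) ℝ) (q u : E m)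
    (i j : Fin m) : ℝ :=
  match s with
  | .imr => D ((1 / 2 : ℝ) • (q + u)) i j
  | .gsv => 1 / 2 * (D q i j + D u i j)

/-- The form which both schemes share as far as the final position `u` is concerned: a half step
for the momentum, which ends in the intermediate momentum `r`, and a full step for the position.
The step `h` may be negative. -/
def HalfStep (s : Scheme) (V : E m → ℝ) (D : E m → Matrix (Fin m) (Fin m) ℝ) (h : ℝ)
    (q p u r : E m) : Prop :=
  (∀ k, r k = p k - h / 2 * force V D k (forcePoint s q u) r) ∧
    ∀ i, u i = q i + h * ∑ j, stepMatrix s D q u i j * r j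

/-- Time reversal. -/
theorem HalfStep.reverse {s : Scheme} {h : ℝ} {q p u r : E m}
    (hs : HalfStep s V D h q (-p) u r) : HalfStep s V D (-h) q p u (-r) := by
  refine ⟨fun k => ?_, fun i => ?_⟩
  · have := hs.1 k
    simp only [PiLp.neg_apply, force_neg] at this ⊢
    linarith
  · rw [hs.2 i]
    simp

/-- The coefficient of `h² / 2` in the average of `f` over the two final positions which belong
to the momenta `p` and `-p`. -/
noncomputable def secondOrder (V : E m → ℝ) (D : E m → Matrix (Fin m) (Fin m) ℝ) (f : E m → ℝ)
    (q p : E m) : ℝ :=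
  ∑ i, pd i f q * ((∑ j, (∑ k, (∑ l, D q k l * p l) * pd k (fun q => D q i j) q) * p j)
      - ∑ j, D q i j * force V D j q p)
    + ∑ j, ∑ i, (∑ l, D q j l * p l) * (∑ l, D q i l * p l) * pd i (pd j f) q

theorem forcePoint_mem (hconv : Convex ℝ O) (s : Scheme) {q u : E m} (hq : q ∈ O) (hu : u ∈ O) :
    forcePoint s q u ∈ O := by
  cases s with
  | imr =>
    have := hconv hq hu (a := 1 / 2) (b := 1 / 2) (by norm_num) (by norm_num) (by norm_num)
    rwa [← smul_add] at this
  | gsv => exact hq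

variable {ι : Type*} {σ : Scale ι} {q p u v r t : ι → E m} {s : Scheme}

theorem polyOVec_forcePoint_sub {k : ℕ} (hu : PolyOVec σ k fun i => u i - q i) :
    PolyOVec σ k fun i => forcePoint s (q i) (u i) - q i := by
  cases s with
  | imr => exact (hu.const_smul (1 / 2)).congr fun i => by simp only [forcePoint]; module
  | gsv => exact (hu.const_smul 0).congr fun i => by simp [forcePoint]

theorem nearVal_comp (hO : IsOpen O) (hconv : Convex ℝ O) {g : E m → ℝ} (hg : SmoothPoly O g)
    (hq : PolyOVec σ 0 q) (hqO : ∀ i, q i ∈ O) (huO : ∀ i, u i ∈ O)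
    (hu : PolyOVec σ 1 fun i => u i - q i) : NearVal σ (fun i => g (q i)) (fun i => g (u i)) :=
  ⟨hg.polyO_comp hq hqO, hg.polyO_sub hO hconv hq hqO huO hu⟩

theorem nearVal_stepMatrix (hO : IsOpen O) (hconv : Convex ℝ O) (hVD : Admissible O V D a b c)
    (hq : PolyOVec σ 0 q) (hqO : ∀ i, q i ∈ O) (huO : ∀ i, u i ∈ O)
    (hu : PolyOVec σ 1 fun i => u i - q i) (i j : Fin m) :
    NearVal σ (fun x => D (q x) i j) (fun x => stepMatrix s D (q x) (u x) i j) := by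
  cases s with
  | imr =>
    exact nearVal_comp hO hconv (hVD.D_smooth i j) (u := fun x => forcePoint .imr (q x) (u x))
      hq hqO (fun x => forcePoint_mem hconv .imr (hqO x) (huO x))
      (polyOVec_forcePoint_sub (s := .imr) hu)
  | gsv =>
    have h1 := nearVal_comp hO hconv (hVD.D_smooth i j) hq hqO huO hu
    exact ⟨h1.base, (h1.near.const_mul (1 / 2)).congr fun x => by simp only [stepMatrix]; ring⟩

theorem nearVal_force (hO : IsOpen O) (hconv : Convex ℝ O) (hVD : Admissible O V D a b c)
    (hq : PolyOVec σ 0 q) (hqO : ∀ i, q i ∈ O) (huO : ∀ i, u i ∈ O)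
    (hu : PolyOVec σ 1 fun i => u i - q i)
    (hr : ∀ j, NearVal σ (fun x => p x j) (fun x => r x j)) (k : Fin m) :
    NearVal σ (fun x => force V D k (q x) (p x)) (fun x => force V D k (u x) (r x)) :=
  (nearVal_comp hO hconv ((hVD.pot_smooth hO).pd hO k) hq hqO huO hu).add
    ((nearVal_const σ (1 / 2)).mul (NearVal.sum _ fun i _ => NearVal.sum _ fun j _ =>
      ((nearVal_comp hO hconv ((hVD.D_smooth i j).pd hO k) hq hqO huO hu).mul (hr i)).mul (hr j)))

theorem polyO_force (hO : IsOpen O) (hVD : Admissible O V D a b c)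
    (hq : PolyOVec σ 0 q) (hqO : ∀ i, q i ∈ O) (hp : PolyOVec σ 0 p) (k : Fin m) :
    PolyO σ 0 fun x => force V D k (q x) (p x) :=
  (((hVD.pot_smooth hO).pd hO k).polyO_comp hq hqO).add
    ((PolyO.sum _ fun i _ => PolyO.sum _ fun j _ =>
      ((((hVD.D_smooth i j).pd hO k).polyO_comp hq hqO).mul (hp.apply i)).mul
        (hp.apply j)).const_mul (1 / 2))

theorem SymmPair.force (hO : IsOpen O) (hconv : Convex ℝ O) (hVD : Admissible O V D a b c)
    (hp : SymmPair σ q u v O)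
    (hr : ∀ j, SymmVal σ (fun x => p x j) (fun x => r x j) (fun x => t x j)) (k : Fin m) :
    SymmVal σ (fun x => force V D k (q x) (p x)) (fun x => RMHMC.force V D k (u x) (r x))
      (fun x => RMHMC.force V D k (v x) (t x)) :=
  (hp.comp hO hconv ((hVD.pot_smooth hO).pd hO k)).add
    ((symmVal_const σ (1 / 2)).mul (SymmVal.sum _ fun i _ => SymmVal.sum _ fun j _ =>
      ((hp.comp hO hconv ((hVD.D_smooth i j).pd hO k)).mul (hr i)).mul (hr j)))

theorem SymmPair.forcePoint (hconv : Convex ℝ O) (hp : SymmPair σ q u v O) (s : Scheme) :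
    SymmPair σ q (fun i => RMHMC.forcePoint s (q i) (u i))
      (fun i => RMHMC.forcePoint s (q i) (v i)) O where
  base := hp.base
  base_mem := hp.base_mem
  left_mem := fun i => forcePoint_mem hconv s (hp.base_mem i) (hp.left_mem i)
  right_mem := fun i => forcePoint_mem hconv s (hp.base_mem i) (hp.right_mem i)
  left := polyOVec_forcePoint_sub hp.left
  right := polyOVec_forcePoint_sub hp.right
  symm := by
    cases s with
    | imr =>
      refine (hp.symm.const_smul (1 / 2)).congr fun i => ?_
      simp only [RMHMC.forcePoint]
      module
    | gsv =>
      refine (hp.symm.const_smul 0).congr fun i => ?_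
      simp only [RMHMC.forcePoint]
      module

theorem SymmPair.stepMatrix (hO : IsOpen O) (hconv : Convex ℝ O) (hVD : Admissible O V D a b c)
    (hp : SymmPair σ q u v O) (s : Scheme) (i j : Fin m) :
    SymmVal σ (fun x => D (q x) i j) (fun x => stepMatrix s D (q x) (u x) i j)
      (fun x => RMHMC.stepMatrix s D (q x) (v x) i j) := by
  cases s with
  | imr => exact (hp.forcePoint hconv .imr).comp hO hconv (hVD.D_smooth i j)
  | gsv =>
    have h1 := hp.comp hO hconv (hVD.D_smooth i j)
    exact ⟨h1.base, (h1.left.const_mul (1 / 2)).congr fun x => by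
        simp only [RMHMC.stepMatrix]; ring,
      (h1.right.const_mul (1 / 2)).congr fun x => by simp only [RMHMC.stepMatrix]; ring,
      (h1.symm.const_mul (1 / 2)).congr fun x => by simp only [RMHMC.stepMatrix]; ring⟩

theorem SymmPair.stepMatrix_odd (hO : IsOpen O) (hconv : Convex ℝ O)
    (hVD : Admissible O V D a b c) (hp : SymmPair σ q u v O) (s : Scheme) (i j : Fin m) :
    PolyO σ 3 fun x => RMHMC.stepMatrix s D (q x) (u x) i j
      - RMHMC.stepMatrix s D (q x) (v x) i j
      - 1 / 2 * ∑ k, (u x - v x) k * pd k (fun q => D q i j) (q x) := by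
  cases s with
  | imr =>
    refine ((hp.forcePoint hconv .imr).polyO_odd hO hconv (hVD.D_smooth i j)).congr fun x => ?_
    simp only [RMHMC.stepMatrix, RMHMC.forcePoint]
    congr 1
    rw [Finset.mul_sum]
    refine Finset.sum_congr rfl fun k _ => ?_
    simp only [PiLp.sub_apply, PiLp.smul_apply, PiLp.add_apply, smul_eq_mul]
    ring
  | gsv =>
    exact ((hp.polyO_odd hO hconv (hVD.D_smooth i j)).const_mul (1 / 2)).congr fun x => by
      simp only [RMHMC.stepMatrix]; ring

/-- One step forward and one step backward from the same configuration: the final positions form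
a symmetric pair, whose even and odd parts are computed up to `O(h⁴)` and `O(h³)`. -/
theorem HalfStep.expansion (hO : IsOpen O) (hconv : Convex ℝ O) (hVD : Admissible O V D a b c)
    (hu : ∀ i, HalfStep s V D (σ.h i) (q i) (p i) (u i) (r i))
    (hv : ∀ i, HalfStep s V D (-σ.h i) (q i) (p i) (v i) (t i))
    (hqO : ∀ i, q i ∈ O) (huO : ∀ i, u i ∈ O) (hvO : ∀ i, v i ∈ O)
    (hq0 : PolyOVec σ 0 q) (hp0 : PolyOVec σ 0 p) (hu1 : PolyOVec σ 1 fun i => u i - q i)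
    (hv1 : PolyOVec σ 1 fun i => v i - q i) (hr0 : PolyOVec σ 0 r) (ht0 : PolyOVec σ 0 t) :
    SymmPair σ q u v O ∧
    (∀ i, PolyO σ 3 fun x => u x i - v x i - 2 * (σ.h x * ∑ l, D (q x) i l * p x l)) ∧
    ∀ i, PolyO σ 4 fun x => u x i + v x i - 2 * q x i - σ.h x * (σ.h x *
      ((∑ j, (∑ k, (∑ l, D (q x) k l * p x l) * pd k (fun q => D q i j) (q x)) * p x j)
      - ∑ j, D (q x) i j * force V D j (q x) (p x))) := by
  have hζu := polyOVec_forcePoint_sub (s := s) hu1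
  have hζv := polyOVec_forcePoint_sub (s := s) hv1
  have hζuO : ∀ i, forcePoint s (q i) (u i) ∈ O := fun i => forcePoint_mem hconv s (hqO i) (huO i)
  have hζvO : ∀ i, forcePoint s (q i) (v i) ∈ O := fun i => forcePoint_mem hconv s (hqO i) (hvO i)
  have hζu0 : PolyOVec σ 0 fun i => forcePoint s (q i) (u i) :=
    ((hζu.weaken (Nat.zero_le _)).add hq0).congr fun i => by module
  have hζv0 : PolyOVec σ 0 fun i => forcePoint s (q i) (v i) :=
    ((hζv.weaken (Nat.zero_le _)).add hq0).congr fun i => by module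
  -- first order
  have hr1 : ∀ j, NearVal σ (fun x => p x j) (fun x => r x j) := fun j =>
    ⟨hp0.apply j, ((polyO_force hO hVD hζu0 hζuO hr0 j).h_mul.const_mul (-(1 / 2))).congr
      fun x => by rw [(hu x).1 j]; ring⟩
  have ht1 : ∀ j, NearVal σ (fun x => p x j) (fun x => t x j) := fun j =>
    ⟨hp0.apply j, ((polyO_force hO hVD hζv0 hζvO ht0 j).h_mul.const_mul (1 / 2)).congr
      fun x => by rw [(hv x).1 j]; ring⟩
  have hFu := fun k => nearVal_force hO hconv hVD hq0 hqO hζuO hζu hr1 k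
  have hFv := fun k => nearVal_force hO hconv hVD hq0 hqO hζvO hζv ht1 k
  have hMu := fun i => NearVal.sum Finset.univ fun j _ =>
    (nearVal_stepMatrix (s := s) hO hconv hVD hq0 hqO huO hu1 i j).mul (hr1 j)
  have hMv := fun i => NearVal.sum Finset.univ fun j _ =>
    (nearVal_stepMatrix (s := s) hO hconv hVD hq0 hqO hvO hv1 i j).mul (ht1 j)
  -- the symmetry of positions and momenta
  have hpair : SymmPair σ q u v O :=
    { base := hq0, base_mem := hqO, left_mem := huO, right_mem := hvO, left := hu1, right := hv1
      symm := PolyOVec.of_apply fun i =>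
        ((hMu i).near.sub (hMv i).near).h_mul.congr fun x => by
          simp only [PiLp.add_apply, PiLp.sub_apply, PiLp.smul_apply, smul_eq_mul]
          rw [(hu x).2 i, (hv x).2 i]; ring }
  have hrt : ∀ j, SymmVal σ (fun x => p x j) (fun x => r x j) (fun x => t x j) := fun j =>
    { base := hp0.apply j, left := (hr1 j).near, right := (ht1 j).near
      symm := (((hFu j).near.sub (hFv j).near).h_mul.const_mul (-(1 / 2))).congr fun x => by
        rw [(hu x).1 j, (hv x).1 j]; ring }
  have hF := fun k => (hpair.forcePoint hconv s).force hO hconv hVD hrt k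
  have hD := fun i j => hpair.stepMatrix hO hconv hVD s i j
  have hM := fun i => SymmVal.sum Finset.univ fun j _ => (hD i j).mul (hrt j)
  -- the odd parts of positions, momenta and matrices
  have hodd : ∀ i, PolyO σ 3 fun x =>
      u x i - v x i - 2 * (σ.h x * ∑ l, D (q x) i l * p x l) := fun i =>
    (hM i).symm.h_mul.congr fun x => by rw [(hu x).2 i, (hv x).2 i]; ring
  have hrodd : ∀ j, PolyO σ 3 fun x =>
      r x j - t x j + σ.h x * force V D j (q x) (p x) := fun j =>
    ((hF j).symm.h_mul.const_mul (-(1 / 2))).congr fun x => by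
      rw [(hu x).1 j, (hv x).1 j]; ring
  have hDodd : ∀ i j, PolyO σ 3 fun x => stepMatrix s D (q x) (u x) i j
      - stepMatrix s D (q x) (v x) i j
      - σ.h x * ∑ k, (∑ l, D (q x) k l * p x l) * pd k (fun q => D q i j) (q x) := by
    intro i j
    have h1 := PolyO.sum Finset.univ fun k _ => (hodd k).mul
      (((hVD.D_smooth i j).pd hO k).polyO_comp hq0 hqO)
    refine ((hpair.stepMatrix_odd hO hconv hVD s i j).add (h1.const_mul (1 / 2))).congr
      fun x => ?_
    simp only [sub_mul, Finset.sum_sub_distrib, PiLp.sub_apply, mul_assoc, ← Finset.mul_sum]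
    ring
  refine ⟨hpair, hodd, fun i => ?_⟩
  have hDp : ∀ i j, PolyO σ 0 fun x =>
      ∑ k, (∑ l, D (q x) k l * p x l) * pd k (fun q => D q i j) (q x) := fun i j =>
    PolyO.sum _ fun k _ => (PolyO.sum _ fun l _ =>
      ((hVD.D_smooth k l).polyO_comp hq0 hqO).mul (hp0.apply l)).mul
      (((hVD.D_smooth i j).pd hO k).polyO_comp hq0 hqO)
  have hF0 := fun j => polyO_force hO hVD hq0 hqO hp0 j
  -- the product rule `AB - A'B' = (A - A')(B + B')/2 + (A + A')/2 (B - B')`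
  have hprod : ∀ j, PolyO σ 3 fun x => stepMatrix s D (q x) (u x) i j * r x j
      - stepMatrix s D (q x) (v x) i j * t x j
      - σ.h x * ((∑ k, (∑ l, D (q x) k l * p x l) * pd k (fun q => D q i j) (q x)) * p x j
        - D (q x) i j * force V D j (q x) (p x)) := by
    intro j
    have a1 := ((hDodd i j).mul ((hrt j).polyO_left.add (hrt j).polyO_right)).const_mul (1 / 2)
    have a2 := (((hDp i j).h_mul).mul (hrt j).symm).const_mul (1 / 2)
    have a3 := ((hrodd j).mul ((hD i j).polyO_left.add (hD i j).polyO_right)).const_mul (1 / 2)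
    have a4 := (((hF0 j).h_mul).mul (hD i j).symm).const_mul (-(1 / 2))
    exact ((a1.add a2).add (a3.add a4)).congr fun x => by ring
  refine (PolyO.sum Finset.univ fun j _ => hprod j).h_mul.congr fun x => ?_
  rw [(hu x).2 i, (hv x).2 i]
  simp only [Finset.sum_sub_distrib, ← Finset.mul_sum]
  ring

/-- No term of order `h³` is left in the average over a forward and a backward step. -/
theorem HalfStep.polyO_average (hO : IsOpen O) (hconv : Convex ℝ O)
    (hVD : Admissible O V D a b c) {f : E m → ℝ} (hf : SmoothPoly O f)
    (hu : ∀ i, HalfStep s V D (σ.h i) (q i) (p i) (u i) (r i))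
    (hv : ∀ i, HalfStep s V D (-σ.h i) (q i) (p i) (v i) (t i))
    (hqO : ∀ i, q i ∈ O) (huO : ∀ i, u i ∈ O) (hvO : ∀ i, v i ∈ O)
    (hq0 : PolyOVec σ 0 q) (hp0 : PolyOVec σ 0 p) (hu1 : PolyOVec σ 1 fun i => u i - q i)
    (hv1 : PolyOVec σ 1 fun i => v i - q i) (hr0 : PolyOVec σ 0 r) (ht0 : PolyOVec σ 0 t) :
    PolyO σ 4 fun x => 1 / 2 * (f (u x) + f (v x)) - f (q x)
      - σ.h x ^ 2 / 2 * secondOrder V D f (q x) (p x) := by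
  obtain ⟨hpair, hodd, heven⟩ :=
    HalfStep.expansion hO hconv hVD hu hv hqO huO hvO hq0 hp0 hu1 hv1 hr0 ht0
  have hf1 := fun i => (hf.pd hO i).polyO_comp hq0 hqO
  have hf2 := fun i j => ((hf.pd hO j).pd hO i).polyO_comp hq0 hqO
  have b1 := PolyO.sum Finset.univ fun i _ => (heven i).mul (hf1 i)
  have hr := hpair.half_sub
  have hd : ∀ i, PolyO σ 0 fun x => ∑ l, D (q x) i l * p x l := fun i =>
    PolyO.sum _ fun l _ => ((hVD.D_smooth i l).polyO_comp hq0 hqO).mul (hp0.apply l)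
  have b2 := PolyO.sum Finset.univ fun j _ => PolyO.sum Finset.univ fun i _ =>
    (((hodd j).mul (hr.apply i)).add ((hd j).h_mul.mul (hodd i))).mul (hf2 i j)
  refine (((hpair.polyO_even hO hconv hf).add (b1.const_mul (1 / 2))).add
    (b2.const_mul (1 / 4))).congr fun x => ?_
  have e1 : jet 1 f (q x) ((1 / 2 : ℝ) • (u x + v x) - q x)
      = 1 / 2 * ∑ i, (u x i + v x i - 2 * q x i) * pd i f (q x) := by
    simp only [jet, Finset.mul_sum, PiLp.sub_apply, PiLp.smul_apply, PiLp.add_apply, smul_eq_mul]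
    exact Finset.sum_congr rfl fun i _ => by ring
  have e2 : jet 2 f (q x) ((1 / 2 : ℝ) • (u x - v x))
      = 1 / 4 * ∑ j, ∑ i, (u x j - v x j) * (u x i - v x i) * pd i (pd j f) (q x) := by
    simp only [jet, Finset.mul_sum, PiLp.sub_apply, PiLp.smul_apply, smul_eq_mul]
    exact Finset.sum_congr rfl fun j _ => Finset.sum_congr rfl fun i _ => by ring
  rw [e1, e2]
  have e3 : ∀ (h : ℝ) (d w : Fin m → ℝ) (P : Fin m → Fin m → ℝ),
      ∑ j, ∑ i, ((w j - 2 * (h * d j)) * (1 / 2 * w i) + (h * d j) * (w i - 2 * (h * d i))) * P i j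
        = 1 / 2 * (∑ j, ∑ i, w j * w i * P i j)
          - 2 * h ^ 2 * ∑ j, ∑ i, d j * d i * P i j := by
    intro h d w P
    simp only [Finset.mul_sum, ← Finset.sum_sub_distrib]
    exact Finset.sum_congr rfl fun j _ => Finset.sum_congr rfl fun i _ => by ring
  have e4 : ∀ (h : ℝ) (w y P : Fin m → ℝ),
      ∑ i, (w i - h * (h * y i)) * P i = ∑ i, w i * P i - h ^ 2 * ∑ i, P i * y i := by
    intro h w y P
    simp only [Finset.mul_sum, ← Finset.sum_sub_distrib]
    exact Finset.sum_congr rfl fun i _ => by ring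
  rw [e4 (σ.h x) (fun i => u x i + v x i - 2 * q x i)]
  simp only [PiLp.smul_apply, PiLp.sub_apply, smul_eq_mul]
  rw [e3 (σ.h x) (fun i => ∑ l, D (q x) i l * p x l) (fun i => u x i - v x i)
    (fun i j => pd i (pd j f) (q x)), secondOrder]
  ring

end Scheme

/-! ### A priori estimates -/

section APriori

variable {m : ℕ} {O : Set (E m)} {V : E m → ℝ} {D : E m → Matrix (Fin m) (Fin m) ℝ} {a b c : ℝ}

theorem norm_gradP_ham_le (hVD : Admissible O V D a b c) {x : X m} (hx : x.1 ∈ O) :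
    ‖gradP (ham V D) x‖ ≤ (m * m * b) * ‖x.2‖ := by
  have h : gradP (ham V D) x = WithLp.toLp 2 (D x.1 *ᵥ x.2.ofLp) := by
    ext k
    rw [gradP_ham_apply hVD hx]
    rfl
  rw [h]
  exact norm_mulVec_le (hVD.abs_D_le hx) x.2

/-- The derivative of the energy along the Hamiltonian vector field vanishes; here `k` is the
velocity `D p`. -/
theorem sum_force_mul (k : Fin m → ℝ) (hVD : Admissible O V D a b c) {x : X m} (hx : x.1 ∈ O)
    (hk : ∀ i, k i = ∑ j, D x.1 i j * x.2 j) :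
    ∑ j, k j * pd j (pot V D) x.1
      + 1 / 2 * ∑ i, ∑ j, (((∑ l, k l * pd l (fun q => D q i j) x.1) * x.2 i
        + D x.1 i j * -force V D i x.1 x.2) * x.2 j
        + D x.1 i j * x.2 i * -force V D j x.1 x.2) = 0 := by
  have h1 : ∑ i, ∑ j, D x.1 i j * force V D i x.1 x.2 * x.2 j
      = ∑ l, k l * force V D l x.1 x.2 := by
    refine Finset.sum_congr rfl fun i _ => ?_
    rw [hk, Finset.sum_mul]
    exact Finset.sum_congr rfl fun j _ => by ring
  have h2 : ∑ i, ∑ j, D x.1 i j * x.2 i * force V D j x.1 x.2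
      = ∑ l, k l * force V D l x.1 x.2 := by
    rw [Finset.sum_comm]
    refine Finset.sum_congr rfl fun j _ => ?_
    rw [hk, Finset.sum_mul]
    refine Finset.sum_congr rfl fun i _ => ?_
    rw [apply_comm_of_posDef (hVD.posDef _ hx) i j]
  have h3 : ∑ l, k l * force V D l x.1 x.2 = ∑ l, k l * pd l (pot V D) x.1
      + 1 / 2 * ∑ i, ∑ j, (∑ l, k l * pd l (fun q => D q i j) x.1) * x.2 i * x.2 j := by
    simp only [force, mul_add, Finset.sum_add_distrib]
    congr 1
    simp only [Finset.mul_sum, Finset.sum_mul]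
    rw [Finset.sum_comm]
    refine Finset.sum_congr rfl fun i _ => ?_
    rw [Finset.sum_comm]
    refine Finset.sum_congr rfl fun j _ => Finset.sum_congr rfl fun l _ => ?_
    ring
  have h4 : ∑ i, ∑ j, (((∑ l, k l * pd l (fun q => D q i j) x.1) * x.2 i
        + D x.1 i j * -force V D i x.1 x.2) * x.2 j
        + D x.1 i j * x.2 i * -force V D j x.1 x.2)
      = ∑ i, ∑ j, (∑ l, k l * pd l (fun q => D q i j) x.1) * x.2 i * x.2 j
        - ∑ i, ∑ j, D x.1 i j * force V D i x.1 x.2 * x.2 j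
        - ∑ i, ∑ j, D x.1 i j * x.2 i * force V D j x.1 x.2 := by
    simp only [← Finset.sum_sub_distrib]
    exact Finset.sum_congr rfl fun i _ => Finset.sum_congr rfl fun j _ => by ring
  rw [h4, h1, h2]
  linarith

/-- Conservation of energy. -/
theorem IsHamTrajectory.ham_eq (hO : IsOpen O) (hVD : Admissible O V D a b c) {T : ℝ} {x : X m}
    {γ : ℝ → X m} (hγ : IsHamTrajectory O (ham V D) T x γ) {t : ℝ} (ht : t ∈ Icc 0 T) :
    ham V D (γ t) = ham V D x := by
  have hderiv : ∀ t ∈ Icc 0 T, HasDerivWithinAt (fun t => ham V D (γ t)) 0 (Icc 0 T) t := by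
    intro t ht
    obtain ⟨hO', hd⟩ := hγ.2 t ht
    have hq : (γ t).1 ∈ O := hO'
    have d1 : HasDerivWithinAt (fun t => (γ t).1) (gradP (ham V D) (γ t)) (Icc 0 T) t :=
      (ContinuousLinearMap.fst ℝ (E m) (E m)).hasFDerivAt.comp_hasDerivWithinAt t hd
    have d2 : HasDerivWithinAt (fun t => (γ t).2) (-gradQ (ham V D) (γ t)) (Icc 0 T) t :=
      (ContinuousLinearMap.snd ℝ (E m) (E m)).hasFDerivAt.comp_hasDerivWithinAt t hd
    have d3 : ∀ i, HasDerivWithinAt (fun t => (γ t).2 i) (-force V D i (γ t).1 (γ t).2)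
        (Icc 0 T) t := fun i => by
      have := (hasFDerivAt_coord i (γ t).2).comp_hasDerivWithinAt t d2
      refine this.congr_deriv ?_
      rw [← gradQ_ham_apply hO hVD hq]
      simp
    have d4 : ∀ g : E m → ℝ, SmoothPoly O g → HasDerivWithinAt (fun t => g (γ t).1)
        (∑ l, gradP (ham V D) (γ t) l * pd l g (γ t).1) (Icc 0 T) t := fun g hg => by
      have := (hg.hasFDerivAt hO hq).comp_hasDerivWithinAt t d1
      rwa [fderiv_eq_sum_pd] at this
    have d5 := (d4 _ (hVD.pot_smooth hO)).add (HasDerivWithinAt.const_mul (1 / 2)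
      (HasDerivWithinAt.fun_sum (u := Finset.univ) fun i _ =>
        HasDerivWithinAt.fun_sum (u := Finset.univ) fun j _ =>
        ((d4 _ (hVD.D_smooth i j)).mul (d3 i)).mul (d3 j)))
    simp only [RMHMC.ham_eq]
    refine d5.congr_deriv ?_
    exact sum_force_mul _ hVD hq fun i => gradP_ham_apply hVD hq i
  have h := norm_image_sub_le_of_norm_deriv_le_segment' (C := 0) hderiv (fun t _ => by simp) t ht
  rw [zero_mul] at h
  have h' := norm_le_zero_iff.1 h
  rw [hγ.1] at h'
  linarith

variable {ι : Type*} {σ : Scale ι}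

theorem polyO_ham (hO : IsOpen O) (hVD : Admissible O V D a b c) {x : ι → X m}
    (hxO : ∀ i, x i ∈ conf O) (h1 : PolyOVec σ 0 fun i => (x i).1)
    (h2 : PolyOVec σ 0 fun i => (x i).2) : PolyO σ 0 fun i => ham V D (x i) :=
  (((hVD.pot_smooth hO).polyO_comp h1 hxO).add
    ((PolyO.sum Finset.univ fun i _ => PolyO.sum Finset.univ fun j _ =>
      (((hVD.D_smooth i j).polyO_comp h1 hxO).mul (h2.apply i)).mul
        (h2.apply j)).const_mul (1 / 2))).congr fun _ => RMHMC.ham_eq _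

theorem polyO_ham_sub (hO : IsOpen O) (hconv : Convex ℝ O) (hVD : Admissible O V D a b c) {k : ℕ}
    {x y : ι → X m} (hxO : ∀ i, x i ∈ conf O) (hyO : ∀ i, y i ∈ conf O)
    (h1 : PolyOVec σ 0 fun i => (x i).1) (h2 : PolyOVec σ 0 fun i => (x i).2)
    (h3 : PolyOVec σ k fun i => (y i).1 - (x i).1) (h4 : PolyOVec σ k fun i => (y i).2 - (x i).2) :
    PolyO σ k fun i => ham V D (y i) - ham V D (x i) := by
  have hy1 : PolyOVec σ 0 fun i => (y i).1 :=
    ((h3.weaken (Nat.zero_le _)).add h1).congr fun i => by module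
  have hy2 : PolyOVec σ 0 fun i => (y i).2 :=
    ((h4.weaken (Nat.zero_le _)).add h2).congr fun i => by module
  have hpot := (hVD.pot_smooth hO).polyO_sub hO hconv h1 hxO hyO h3
  have hsum := PolyO.sum Finset.univ fun i _ => PolyO.sum Finset.univ fun j _ =>
    (((((hVD.D_smooth i j).polyO_sub hO hconv h1 hxO hyO h3).mul (hy2.apply i)).mul
      (hy2.apply j)).add
    (((h4.apply i).mul ((hVD.D_smooth i j).polyO_comp h1 hxO)).mul (hy2.apply j))).add
    (((h4.apply j).mul ((hVD.D_smooth i j).polyO_comp h1 hxO)).mul (h2.apply i))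
  refine (hpot.add (hsum.const_mul (1 / 2))).congr fun x => ?_
  rw [RMHMC.ham_eq, RMHMC.ham_eq, add_sub_add_comm, ← mul_sub]
  simp only [← Finset.sum_sub_distrib]
  congr 2
  refine Finset.sum_congr rfl fun i _ => Finset.sum_congr rfl fun j _ => ?_
  simp only [PiLp.sub_apply]
  ring

/-- The exact Hamiltonian flow over one time step: energy conservation bounds the momentum along
the trajectory, hence also the displacement of the position. -/
theorem polyOVec_trajectory (hO : IsOpen O) (hVD : Admissible O V D a b c) {x : ι → X m}
    {γ : ι → ℝ → X m} (hγ : ∀ i, IsHamTrajectory O (ham V D) (σ.h i) (x i) (γ i))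
    (hxO : ∀ i, x i ∈ conf O) (h1 : PolyOVec σ 0 fun i => (x i).1)
    (h2 : PolyOVec σ 0 fun i => (x i).2) :
    PolyOVec σ 1 (fun i => (γ i (σ.h i)).1 - (x i).1) ∧
    PolyOVec σ 0 (fun i => (γ i (σ.h i)).2) := by
  obtain ⟨L, hL⟩ := hVD.exists_norm_sq_le
  have ha := hVD.a_pos
  have hb : 0 ≤ b := ha.le.trans hVD.a_le_b
  -- a bound for the momentum along the trajectory, from the conserved energy
  let B : ι → ℝ := fun i => 1 + 2 / a * (ham V D (x i) + L)
  have hB : PolyO σ 0 B :=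
    (polyO_const σ 1).add (((polyO_ham hO hVD hxO h1 h2).add (polyO_const σ L)).const_mul (2 / a))
  have hp : ∀ i, ∀ t ∈ Icc 0 (σ.h i), ‖(γ i t).2‖ ≤ B i := by
    intro i t ht
    have h3 := hL _ ((hγ i).2 t ht).1
    rw [(hγ i).ham_eq hO hVD ht] at h3
    have h4 : ‖(γ i t).2‖ ^ 2 ≤ 2 / a * (ham V D (x i) + L) := by
      rw [div_mul_eq_mul_div, le_div_iff₀ ha]
      linarith
    simp only [B]
    nlinarith [sq_nonneg (‖(γ i t).2‖ - 1)]
  have hh : ∀ i, σ.h i ∈ Icc 0 (σ.h i) := fun i => ⟨(σ.h_pos i).le, le_rfl⟩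
  refine ⟨?_, PolyO.of_le hB fun i => ?_⟩
  · refine PolyO.of_le ((hB.const_mul (m * m * b)).h_mul) fun i => ?_
    rw [abs_of_nonneg (norm_nonneg _)]
    have h5 := norm_image_sub_le_of_norm_deriv_le_segment' (f := fun t => (γ i t).1)
      (f' := fun t => gradP (ham V D) (γ i t)) (C := m * m * b * B i) (a := 0) (b := σ.h i)
      (fun t ht => (ContinuousLinearMap.fst ℝ (E m) (E m)).hasFDerivAt.comp_hasDerivWithinAt t
        ((hγ i).2 t ht).2)
      (fun t ht => by
        have ht' : t ∈ Icc 0 (σ.h i) := ⟨ht.1, ht.2.le⟩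
        refine (norm_gradP_ham_le hVD ((hγ i).2 t ht').1).trans ?_
        gcongr
        exact hp i t ht') (σ.h i) (hh i)
    rw [(hγ i).1, sub_zero] at h5
    refine h5.trans (le_trans (le_of_eq ?_) (le_abs_self _))
    ring
  · rw [abs_of_nonneg (norm_nonneg _)]
    exact (hp i _ (hh i)).trans (le_abs_self _)

theorem le_stepMatrix (hconv : Convex ℝ O) (hVD : Admissible O V D a b c) (s : Scheme)
    {q u : E m} (hq : q ∈ O) (hu : u ∈ O) (r : E m) :
    a * ‖r‖ ^ 2 ≤ ∑ i, r i * ∑ j, stepMatrix s D q u i j * r j := by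
  have key : ∀ q ∈ O, a * ‖r‖ ^ 2 ≤ ∑ i, r i * ∑ j, D q i j * r j := fun q hq =>
    le_quad_of_posSemidef_sub (hVD.lower q hq) r
  cases s with
  | imr => exact key _ (forcePoint_mem hconv .imr hq hu)
  | gsv =>
    have h1 := key q hq
    have h2 := key u hu
    have h3 : ∑ i, r i * ∑ j, stepMatrix .gsv D q u i j * r j
        = 1 / 2 * (∑ i, r i * ∑ j, D q i j * r j + ∑ i, r i * ∑ j, D u i j * r j) := by
      simp only [stepMatrix, Finset.mul_sum, ← Finset.sum_add_distrib]
      exact Finset.sum_congr rfl fun i _ => Finset.sum_congr rfl fun j _ => by ring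
    rw [h3]
    linarith

/-- By ellipticity the intermediate momentum is controlled by the displacement. -/
theorem HalfStep.mul_norm_le (hconv : Convex ℝ O) (hVD : Admissible O V D a b c) {s : Scheme}
    {h : ℝ} {q p u r : E m} (hh : 0 < h) (hs : HalfStep s V D h q p u r) (hq : q ∈ O)
    (hu : u ∈ O) : a * h * ‖r‖ ≤ ‖u - q‖ := by
  have h1 := le_stepMatrix hconv hVD s hq hu r
  have h2 : h * ∑ i, r i * ∑ j, stepMatrix s D q u i j * r j = inner ℝ r (u - q) := by
    rw [PiLp.inner_apply, Finset.mul_sum]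
    refine Finset.sum_congr rfl fun i _ => ?_
    simp only [PiLp.sub_apply, hs.2 i, RCLike.inner_apply, conj_trivial]
    ring
  have h3 := real_inner_le_norm r (u - q)
  rcases (norm_nonneg r).eq_or_lt with h0 | h0
  · rw [← h0, mul_zero]; exact norm_nonneg _
  · have h4 : a * h * ‖r‖ * ‖r‖ ≤ ‖u - q‖ * ‖r‖ := by
      have := mul_le_mul_of_nonneg_left h1 hh.le
      nlinarith
    exact le_of_mul_le_mul_right h4 h0

/-- The equations of either scheme contain a `HalfStep`: the intermediate momentum is the mean of
the initial and the final one for IMR, and the first component of the solver for GSV. -/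
theorem exists_halfStep (hO : IsOpen O) (hconv : Convex ℝ O) (hVD : Admissible O V D a b c)
    {s : Scheme} {h : ℝ} {A : Set (X m)} {χ : X m → Fin (s.inner + 1) → X m}
    (hχ : IsNumericalSolver O (s.phi (ham V D) h) A χ) {x : X m} (hx : x ∈ A) :
    ∃ r, HalfStep s V D h x.1 x.2 (flow χ x).1 r := by
  have hsol := hχ.solves x hx
  have hq : x.1 ∈ O := hχ.subset hx
  have hmem : ∀ i, (χ x i).1 ∈ O := fun i => hχ.mapsTo x hx i
  cases s with
  | imr =>
    have hz : ((1 / 2 : ℝ) • (x + χ x 0)).1 ∈ O := forcePoint_mem hconv .imr hq (hmem 0)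
    have e := congrFun hsol 0
    have e1 : (χ x 0).1 - x.1 - h • gradP (ham V D) ((1 / 2 : ℝ) • (x + χ x 0)) = 0 :=
      congrArg Prod.fst e
    have e2 : (χ x 0).2 - x.2 + h • gradQ (ham V D) ((1 / 2 : ℝ) • (x + χ x 0)) = 0 :=
      congrArg Prod.snd e
    refine ⟨((1 / 2 : ℝ) • (x + χ x 0)).2, fun k => ?_, fun i => ?_⟩
    · have e3 := congrArg (fun v : E m => v k) e2
      simp only [PiLp.add_apply, PiLp.sub_apply, PiLp.smul_apply, smul_eq_mul,
        gradQ_ham_apply hO hVD hz, PiLp.zero_apply] at e3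
      simp only [forcePoint, flow, Prod.smul_fst, Prod.smul_snd, Prod.fst_add, Prod.snd_add,
        PiLp.add_apply, PiLp.smul_apply, smul_eq_mul] at e3 ⊢
      change _ = _ - h / 2 * force V D k ((1 / 2 : ℝ) • (x.1 + (χ x 0).1)) _
      linarith
    · have e3 := congrArg (fun v : E m => v i) e1
      simp only [PiLp.sub_apply, PiLp.smul_apply, smul_eq_mul,
        gradP_ham_apply hVD hz, PiLp.zero_apply] at e3
      change (χ x 0).1 i = x.1 i + h * ∑ j, D ((1 / 2 : ℝ) • (x + χ x 0)).1 i j * _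
      linarith
  | gsv =>
    have e := congrFun hsol 0
    have e' := congrFun hsol 1
    have e1 : (χ x 0).1 - x.1 - (h / 2) • gradP (ham V D) (x.1, (χ x 0).2) = 0 :=
      congrArg Prod.fst e
    have e2 : (χ x 0).2 - x.2 + (h / 2) • gradQ (ham V D) (x.1, (χ x 0).2) = 0 :=
      congrArg Prod.snd e
    have e3 : (χ x 1).1 - (χ x 0).1 - (h / 2) • gradP (ham V D) ((χ x 1).1, (χ x 0).2) = 0 :=
      congrArg Prod.fst e'
    refine ⟨(χ x 0).2, fun k => ?_, fun i => ?_⟩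
    · have e4 := congrArg (fun v : E m => v k) e2
      simp only [PiLp.add_apply, PiLp.sub_apply, PiLp.smul_apply, smul_eq_mul,
        gradQ_ham_apply (x := (x.1, (χ x 0).2)) hO hVD hq, PiLp.zero_apply] at e4
      simp only [forcePoint]
      linarith
    · have e4 := congrArg (fun v : E m => v i) e1
      have e5 := congrArg (fun v : E m => v i) e3
      simp only [PiLp.sub_apply, PiLp.smul_apply, smul_eq_mul,
        gradP_ham_apply (x := (x.1, (χ x 0).2)) hVD hq, PiLp.zero_apply] at e4
      simp only [PiLp.sub_apply, PiLp.smul_apply, smul_eq_mul,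
        gradP_ham_apply (x := ((χ x 1).1, (χ x 0).2)) hVD (hmem 1), PiLp.zero_apply] at e5
      have e6 : ∑ j, stepMatrix .gsv D x.1 (χ x 1).1 i j * (χ x 0).2 j
          = 1 / 2 * (∑ j, D x.1 i j * (χ x 0).2 j + ∑ j, D (χ x 1).1 i j * (χ x 0).2 j) := by
        rw [← Finset.sum_add_distrib, Finset.mul_sum]
        exact Finset.sum_congr rfl fun j _ => by simp only [stepMatrix]; ring
      change (χ x 1).1 i = x.1 i + h * ∑ j, stepMatrix .gsv D x.1 (χ x 1).1 i j * (χ x 0).2 j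
      rw [e6]
      linarith

/-- Time steps in `(0, dtStar]` together with configurations on which the solver is defined. -/
def StepIndex (dtStar : ℝ) (A : ℝ → Set (X m)) : Type :=
  {i : ℝ × X m // i.1 ∈ Ioc 0 dtStar ∧ i.2 ∈ A i.1}

/-- The weight `1 + ‖q‖ + ‖p‖` on `StepIndex`. -/
noncomputable def stepScale (dtStar : ℝ) (A : ℝ → Set (X m)) : Scale (StepIndex dtStar A) where
  w := fun i => 1 + ‖i.1.2.1‖ + ‖i.1.2.2‖
  h := fun i => i.1.1
  one_le_w := fun i => by linarith [norm_nonneg i.1.2.1, norm_nonneg i.1.2.2]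
  h_pos := fun i => i.2.1.1
  exists_h_le := ⟨dtStar, fun i => i.2.1.2⟩

theorem polyOVec_stepScale (dtStar : ℝ) (A : ℝ → Set (X m)) :
    PolyOVec (stepScale dtStar A) 0 (fun i => i.1.2.1) ∧
    PolyOVec (stepScale dtStar A) 0 (fun i => i.1.2.2) := by
  constructor <;>
  · refine PolyO.of_le (polyO_w _) fun i => ?_
    rw [abs_of_nonneg (norm_nonneg _),
      abs_of_pos (zero_lt_one.trans_le ((stepScale dtStar A).one_le_w i))]
    change _ ≤ 1 + ‖i.1.2.1‖ + ‖i.1.2.2‖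
    linarith [norm_nonneg i.1.2.1, norm_nonneg i.1.2.2]

/-- Time steps together with configurations which, along with their momentum reversals, belong to
the domain of the solver. -/
def SymmIndex (dtStar : ℝ) (A : ℝ → Set (X m)) : Type :=
  {i : ℝ × X m // i.1 ∈ Ioc 0 dtStar ∧ i.2 ∈ A i.1 ∧ S i.2 ∈ A i.1}

/-- The weight `1 + ‖q‖ + ‖p‖` on `SymmIndex`. -/
noncomputable def symmScale (dtStar : ℝ) (A : ℝ → Set (X m)) : Scale (SymmIndex dtStar A) where
  w := fun i => 1 + ‖i.1.2.1‖ + ‖i.1.2.2‖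
  h := fun i => i.1.1
  one_le_w := fun i => by linarith [norm_nonneg i.1.2.1, norm_nonneg i.1.2.2]
  h_pos := fun i => i.2.1.1
  exists_h_le := ⟨dtStar, fun i => i.2.1.2⟩

section Solver

variable {s : Scheme} {dtStar : ℝ} {A : ℝ → Set (X m)}
  {χ : ℝ → X m → Fin (s.inner + 1) → X m} {K δ : ℝ}

/-- The proposal moves the position by `O(h)` and changes the energy by `O(h³)`. -/
theorem polyOVec_flow (hO : IsOpen O) (hconv : Convex ℝ O) (hVD : Admissible O V D a b c)
    (hχ : ∀ dt ∈ Ioc 0 dtStar, IsNumericalSolver O (s.phi (ham V D) dt) (A dt) (χ dt))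
    (hδ : 0 ≤ δ)
    (hlocal : ∀ dt ∈ Ioc 0 dtStar, ∀ x ∈ A dt, ∃ γ : ℝ → X m,
      IsHamTrajectory O (ham V D) dt x γ ∧
      ‖flow (χ dt) x - γ dt‖ ≤ K * dt ^ 3 * (1 + ‖x.1‖ ^ δ + ‖x.2‖ ^ δ)) :
    PolyOVec (stepScale dtStar A) 1 (fun i => (flow (χ i.1.1) i.1.2).1 - i.1.2.1) ∧
    PolyO (stepScale dtStar A) 3
      (fun i => ham V D (flow (χ i.1.1) i.1.2) - ham V D i.1.2) := by
  let σ := stepScale dtStar A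
  choose γ hγ hdist using fun i : StepIndex dtStar A => hlocal i.1.1 i.2.1 i.1.2 i.2.2
  have hxO : ∀ i : StepIndex dtStar A, i.1.2 ∈ conf O := fun i =>
    (hχ i.1.1 i.2.1).subset i.2.2
  have hyO : ∀ i : StepIndex dtStar A, flow (χ i.1.1) i.1.2 ∈ conf O := fun i =>
    (hχ i.1.1 i.2.1).mapsTo _ i.2.2 _
  have hγO : ∀ i : StepIndex dtStar A, γ i i.1.1 ∈ conf O := fun i =>
    ((hγ i).2 i.1.1 ⟨i.2.1.1.le, le_rfl⟩).1
  obtain ⟨h1, h2⟩ := polyOVec_stepScale dtStar A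
  obtain ⟨g1, g2⟩ := polyOVec_trajectory (σ := σ) hO hVD hγ hxO h1 h2
  have g0 : PolyOVec σ 0 fun i => (γ i i.1.1).1 :=
    ((g1.weaken (Nat.zero_le _)).add h1).congr fun i => by
      change _ = (γ i i.1.1).1 - i.1.2.1 + i.1.2.1
      module
  have hh3 : PolyO σ 3 fun i => i.1.1 ^ 3 :=
    (((polyO_h σ).mul (polyO_h σ)).mul (polyO_h σ)).congr fun i => by
      change i.1.1 ^ 3 = i.1.1 * i.1.1 * i.1.1
      ring
  have hbound : PolyO σ 3 fun i => K * i.1.1 ^ 3 * (1 + ‖i.1.2.1‖ ^ δ + ‖i.1.2.2‖ ^ δ) :=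
    (hh3.const_mul K).mul (((polyO_const σ 1).add
      (PolyO.rpow h1 (fun i => norm_nonneg _) hδ)).add (PolyO.rpow h2 (fun i => norm_nonneg _) hδ))
  have e1 : PolyOVec σ 3 fun i => (flow (χ i.1.1) i.1.2).1 - (γ i i.1.1).1 :=
    hbound.of_le fun i => by
      rw [abs_of_nonneg (norm_nonneg _)]
      exact ((norm_fst_le (flow (χ i.1.1) i.1.2 - γ i i.1.1)).trans (hdist i)).trans
        (le_abs_self _)
  have e2 : PolyOVec σ 3 fun i => (flow (χ i.1.1) i.1.2).2 - (γ i i.1.1).2 :=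
    hbound.of_le fun i => by
      rw [abs_of_nonneg (norm_nonneg _)]
      exact ((norm_snd_le (flow (χ i.1.1) i.1.2 - γ i i.1.1)).trans (hdist i)).trans
        (le_abs_self _)
  refine ⟨((e1.weaken (by norm_num)).add g1).congr fun i => ?_, ?_⟩
  · change _ = _ + ((γ i i.1.1).1 - i.1.2.1)
    module
  · refine (polyO_ham_sub hO hconv hVD hγO hyO g0 g2 e1 e2).congr fun i => ?_
    rw [(hγ i).ham_eq hO hVD ⟨i.2.1.1.le, le_rfl⟩]

/-- The average of `f` over the proposals which start from `(q, p)` and from `(q, -p)`. -/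
theorem polyO_symm_average (hO : IsOpen O) (hconv : Convex ℝ O) (hVD : Admissible O V D a b c)
    (hχ : ∀ dt ∈ Ioc 0 dtStar, IsNumericalSolver O (s.phi (ham V D) dt) (A dt) (χ dt))
    (hflow : PolyOVec (stepScale dtStar A) 1 (fun i => (flow (χ i.1.1) i.1.2).1 - i.1.2.1))
    {f : E m → ℝ} (hf : SmoothPoly O f) :
    PolyO (symmScale dtStar A) 4 fun i =>
      1 / 2 * (f (flow (χ i.1.1) i.1.2).1 + f (flow (χ i.1.1) (S i.1.2)).1) - f i.1.2.1
        - i.1.1 ^ 2 / 2 * secondOrder V D f i.1.2.1 i.1.2.2 := by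
  let σ := stepScale dtStar A
  let τ := symmScale dtStar A
  choose r hr using fun i : StepIndex dtStar A =>
    exists_halfStep hO hconv hVD (hχ i.1.1 i.2.1) i.2.2
  have hxO : ∀ i : StepIndex dtStar A, i.1.2.1 ∈ O := fun i => (hχ i.1.1 i.2.1).subset i.2.2
  have hyO : ∀ i : StepIndex dtStar A, (flow (χ i.1.1) i.1.2).1 ∈ O := fun i =>
    (hχ i.1.1 i.2.1).mapsTo _ i.2.2 _
  have hr0 : PolyOVec σ 0 r := by
    obtain ⟨C, hC, N, h⟩ := hflow
    refine ⟨a⁻¹ * C, mul_nonneg (inv_nonneg.2 hVD.a_pos.le) hC, N, fun i => ?_⟩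
    have h1 := (hr i).mul_norm_le hconv hVD i.2.1.1 (hxO i) (hyO i)
    have h2 := h i
    rw [abs_of_nonneg (norm_nonneg _)] at h2 ⊢
    have hi : (0 : ℝ) < i.1.1 := i.2.1.1
    have h3 : a * ‖r i‖ * i.1.1 ≤ (C * σ.w i ^ N) * i.1.1 := by
      calc a * ‖r i‖ * i.1.1 = a * i.1.1 * ‖r i‖ := by ring
        _ ≤ C * σ.w i ^ N * i.1.1 ^ 1 := h1.trans h2
        _ = _ := by ring
    have h4 := le_of_mul_le_mul_right h3 hi
    have h5 := mul_le_mul_of_nonneg_left h4 (inv_nonneg.2 hVD.a_pos.le)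
    rw [← mul_assoc, inv_mul_cancel₀ hVD.a_pos.ne', one_mul] at h5
    simpa [mul_assoc] using h5
  let fw : SymmIndex dtStar A → StepIndex dtStar A := fun i => ⟨i.1, i.2.1, i.2.2.1⟩
  let bw : SymmIndex dtStar A → StepIndex dtStar A := fun i => ⟨(i.1.1, S i.1.2), i.2.1, i.2.2.2⟩
  have hwb : ∀ i, σ.w (bw i) = τ.w i := fun i => by
    change 1 + ‖i.1.2.1‖ + ‖-i.1.2.2‖ = 1 + ‖i.1.2.1‖ + ‖i.1.2.2‖
    rw [norm_neg]
  have hq0 : PolyOVec τ 0 fun i => i.1.2.1 :=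
    (polyOVec_stepScale dtStar A).1.pullback τ fw (fun _ => rfl) (fun _ => rfl)
  have hp0 : PolyOVec τ 0 fun i => i.1.2.2 :=
    (polyOVec_stepScale dtStar A).2.pullback τ fw (fun _ => rfl) (fun _ => rfl)
  exact HalfStep.polyO_average (σ := τ) (q := fun i => i.1.2.1) (p := fun i => i.1.2.2)
    (u := fun i => (flow (χ i.1.1) i.1.2).1) (v := fun i => (flow (χ i.1.1) (S i.1.2)).1)
    (r := fun i => r (fw i)) (t := fun i => -r (bw i)) hO hconv hVD hf
    (fun i => hr (fw i)) (fun i => (hr (bw i)).reverse) (fun i => hxO (fw i))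
    (fun i => hyO (fw i)) (fun i => hyO (bw i)) hq0 hp0
    (hflow.pullback τ fw (fun _ => rfl) (fun _ => rfl))
    (hflow.pullback τ bw hwb (fun _ => rfl))
    (hr0.pullback τ fw (fun _ => rfl) (fun _ => rfl))
    (PolyOVec.neg (hr0.pullback τ bw hwb (fun _ => rfl)))

end Solver

end APriori

/-! ### Gaussian averages -/

section Gaussian

variable {m : ℕ}

theorem measurePreserving_neg_stdGaussian :
    MeasurePreserving (fun g : E m => -g) (stdGaussian (E m)) (stdGaussian (E m)) :=
  ⟨measurable_neg, stdGaussian_map (LinearIsometryEquiv.neg ℝ (E := E m))⟩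

theorem integrable_norm_pow_stdGaussian (n : ℕ) :
    Integrable (fun g : E m => ‖g‖ ^ n) (stdGaussian (E m)) :=
  (IsGaussian.memLp_id (stdGaussian (E m)) n (by simp)).integrable_norm_pow'

/-- `F` is integrable with integral `c`. -/
def HasMean {Ω : Type*} [MeasurableSpace Ω] (μ : Measure Ω) (F : Ω → ℝ) (c : ℝ) : Prop :=
  Integrable F μ ∧ ∫ x, F x ∂μ = c

section HasMean

variable {Ω : Type*} [MeasurableSpace Ω] {μ : Measure Ω} {F G : Ω → ℝ} {c d : ℝ}

theorem hasMean_const [IsProbabilityMeasure μ] (c : ℝ) : HasMean μ (fun _ => c) c :=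
  ⟨integrable_const c, by simp⟩

theorem HasMean.add (hF : HasMean μ F c) (hG : HasMean μ G d) :
    HasMean μ (fun x => F x + G x) (c + d) :=
  ⟨hF.1.add hG.1, by rw [integral_add hF.1 hG.1, hF.2, hG.2]⟩

theorem HasMean.sub (hF : HasMean μ F c) (hG : HasMean μ G d) :
    HasMean μ (fun x => F x - G x) (c - d) :=
  ⟨hF.1.sub hG.1, by rw [integral_sub hF.1 hG.1, hF.2, hG.2]⟩

theorem HasMean.const_mul (hF : HasMean μ F c) (a : ℝ) : HasMean μ (fun x => a * F x) (a * c) :=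
  ⟨hF.1.const_mul a, by rw [integral_const_mul, hF.2]⟩

theorem HasMean.sum {α : Type*} (s : Finset α) {F : α → Ω → ℝ} {c : α → ℝ}
    (hF : ∀ a ∈ s, HasMean μ (F a) (c a)) :
    HasMean μ (fun x => ∑ a ∈ s, F a x) (∑ a ∈ s, c a) :=
  ⟨integrable_finsetSum s fun a ha => (hF a ha).1, by
    rw [integral_finsetSum s fun a ha => (hF a ha).1]
    exact Finset.sum_congr rfl fun a ha => (hF a ha).2⟩

end HasMean

theorem hasMean_mul_stdGaussian (i j : Fin m) :
    HasMean (stdGaussian (E m)) (fun g => g i * g j) (if i = j then 1 else 0) := by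
  have hc : ∀ i : Fin m, MemLp (fun g : E m => g i) 2 (stdGaussian (E m)) := fun i =>
    (EuclideanSpace.proj i : E m →L[ℝ] ℝ).comp_memLp' IsGaussian.memLp_two_id
  refine ⟨(hc i).integrable_mul (hc j), ?_⟩
  have h := covarianceBilin_apply (IsGaussian.memLp_two_id (μ := stdGaussian (E m)))
    (EuclideanSpace.single i (1 : ℝ)) (EuclideanSpace.single j (1 : ℝ))
  rw [covarianceBilin_stdGaussian] at h
  simp only [integral_id_stdGaussian, sub_zero, id,
    EuclideanSpace.inner_single_left] at h
  simp only [map_one, one_mul] at h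
  rw [← h, innerSL_apply_apply ℝ, EuclideanSpace.inner_single_left]
  simp

theorem hasMean_invSqrtMul {M : Matrix (Fin m) (Fin m) ℝ} (hM : M.PosDef) (i j : Fin m) :
    HasMean (stdGaussian (E m)) (fun g => invSqrtMul M g i * invSqrtMul M g j) (M⁻¹ i j) := by
  have h := HasMean.sum Finset.univ fun k _ => HasMean.sum Finset.univ fun l _ =>
    (hasMean_mul_stdGaussian (m := m) k l).const_mul ((CFC.sqrt M)⁻¹ i k * (CFC.sqrt M)⁻¹ j l)
  have e1 : ∀ g : E m, invSqrtMul M g i * invSqrtMul M g j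
      = ∑ k, ∑ l, (CFC.sqrt M)⁻¹ i k * (CFC.sqrt M)⁻¹ j l * (g k * g l) := by
    intro g
    simp only [invSqrtMul, Matrix.mulVec, dotProduct]
    rw [Finset.sum_mul_sum]
    exact Finset.sum_congr rfl fun k _ => Finset.sum_congr rfl fun l _ => by ring
  have e2 : M⁻¹ i j = ∑ k, ∑ l, (CFC.sqrt M)⁻¹ i k * (CFC.sqrt M)⁻¹ j l
      * (if k = l then 1 else 0) := by
    rw [← inv_sqrt_mul_transpose hM, Matrix.mul_apply]
    simp
  simp only [e1, e2]
  exact h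

variable {O : Set (E m)} {V : E m → ℝ} {D : E m → Matrix (Fin m) (Fin m) ℝ} {a b c : ℝ}

/-- The average of the second-order coefficient over the momenta is the generator: the momentum
has covariance `D⁻¹`, so that the quadratic part of the force averages to `½ ∇ ln det D`, by
Jacobi's formula, and cancels the derivative of the term `-½ ln det D` of the Hamiltonian. -/
theorem hasMean_secondOrder (hO : IsOpen O) (hVD : Admissible O V D a b c) (f : E m → ℝ)
    {q : E m} (hq : q ∈ O) :
    HasMean (stdGaussian (E m)) (fun g => secondOrder V D f q (invSqrtMul (D q) g))
      (gen V D f q) := by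
  have hM := hVD.posDef q hq
  have hZ := hasMean_invSqrtMul hM
  have hdet : IsUnit (D q).det := isUnit_iff_ne_zero.2 hM.det_pos.ne'
  have hmean := (HasMean.sum Finset.univ fun i _ => ((HasMean.sum Finset.univ fun j _ =>
      HasMean.sum Finset.univ fun k _ => HasMean.sum Finset.univ fun l _ =>
        (hZ l j).const_mul (D q k l * pd k (fun q => D q i j) q)).sub
      (HasMean.sum Finset.univ fun j _ => ((hasMean_const (pd j (pot V D) q)).add
        ((HasMean.sum Finset.univ fun k _ => HasMean.sum Finset.univ fun l _ =>
          (hZ k l).const_mul (pd j (fun q => D q k l) q)).const_mul (1 / 2))).const_mul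
            (D q i j))).const_mul (pd i f q)).add
    (HasMean.sum Finset.univ fun j _ => HasMean.sum Finset.univ fun i _ =>
      (HasMean.sum Finset.univ fun l _ => HasMean.sum Finset.univ fun l' _ =>
        (hZ l l').const_mul (D q j l * D q i l')).const_mul (pd i (pd j f) q))
  have e1 : ∀ p : E m, secondOrder V D f q p =
      ∑ i, pd i f q * ((∑ j, ∑ k, ∑ l, D q k l * pd k (fun q => D q i j) q * (p l * p j))
        - ∑ j, D q i j * (pd j (pot V D) q
          + 1 / 2 * ∑ k, ∑ l, pd j (fun q => D q k l) q * (p k * p l)))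
      + ∑ j, ∑ i, pd i (pd j f) q * ∑ l, ∑ l', D q j l * D q i l' * (p l * p l') := by
    intro p
    simp only [secondOrder, force, Finset.sum_mul, Finset.mul_sum]
    congr 1
    · refine Finset.sum_congr rfl fun i _ => ?_
      congr 2
      · exact Finset.sum_congr rfl fun j _ => Finset.sum_congr rfl fun k _ =>
          Finset.sum_congr rfl fun l _ => by ring
      · refine Finset.sum_congr rfl fun j _ => ?_
        congr 2
        exact Finset.sum_congr rfl fun k _ => Finset.sum_congr rfl fun l _ => by ring
    · refine Finset.sum_congr rfl fun j _ => Finset.sum_congr rfl fun i _ => ?_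
      rw [Finset.sum_comm]
      exact Finset.sum_congr rfl fun l _ => Finset.sum_congr rfl fun l' _ => by ring
  have hinv : ∀ i j, ∑ l, D q i l * (D q)⁻¹ l j = if i = j then 1 else 0 := fun i j => by
    rw [← Matrix.mul_apply, Matrix.mul_nonsing_inv _ hdet, Matrix.one_apply]
  have hsymm : ∀ i j, (D q)⁻¹ i j = (D q)⁻¹ j i := apply_comm_of_posDef hM.inv
  have hpot : ∀ j, pd j (pot V D) q + 1 / 2 * ∑ k, ∑ l, pd j (fun q => D q k l) q * (D q)⁻¹ k l
      = pd j V q := by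
    intro j
    have h1 := ((hVD.V_smooth.hasFDerivAt hO hq).sub
      (((hVD.log_det_smooth hO).hasFDerivAt hO hq).const_mul (1 / 2))).fderiv
    have h2 : pd j (pot V D) q = pd j V q - 1 / 2 * pd j (fun q => Real.log (D q).det) q := by
      simp only [pd]
      rw [show pot V D = fun q => V q - 1 / 2 * Real.log (D q).det from rfl]
      rw [show (fun q => V q - 1 / 2 * Real.log (D q).det)
        = V - fun q => 1 / 2 * Real.log (D q).det from rfl, h1]
      simp
    rw [h2, pd_log_det (fun i j => ((hVD.D_smooth i j).hasFDerivAt hO hq).differentiableAt)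
      hM.det_pos.ne']
    have h3 : ∑ k, ∑ l, pd j (fun q => D q k l) q * (D q)⁻¹ k l
        = ∑ k, ∑ l, (D q)⁻¹ l k * pd j (fun q => D q k l) q :=
      Finset.sum_congr rfl fun k _ => Finset.sum_congr rfl fun l _ => by
        rw [hsymm k l]; ring
    rw [h3]
    ring
  have hdiv : ∀ i, ∑ j, ∑ k, ∑ l, D q k l * pd k (fun q => D q i j) q * (D q)⁻¹ l j
      = ∑ j, pd j (fun q => D q i j) q := by
    intro i
    refine Finset.sum_congr rfl fun j _ => ?_
    have : ∀ k, ∑ l, D q k l * pd k (fun q => D q i j) q * (D q)⁻¹ l j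
        = pd k (fun q => D q i j) q * if k = j then 1 else 0 := fun k => by
      rw [← hinv, Finset.mul_sum]
      exact Finset.sum_congr rfl fun l _ => by ring
    simp [this]
  have hhess : ∀ j i, ∑ l, ∑ l', D q j l * D q i l' * (D q)⁻¹ l l' = D q i j := by
    intro j i
    have : ∀ l, ∑ l', D q j l * D q i l' * (D q)⁻¹ l l'
        = D q j l * if i = l then 1 else 0 := fun l => by
      rw [← hinv, Finset.mul_sum]
      exact Finset.sum_congr rfl fun l' _ => by rw [hsymm l l']; ring
    simp [this, apply_comm_of_posDef hM j i]
  simp only [hpot, hdiv, hhess] at hmean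
  simp only [e1]
  convert hmean using 1
  rw [gen]
  congr 1
  · exact Finset.sum_congr rfl fun i _ => by ring
  · rw [Finset.sum_comm]
    exact Finset.sum_congr rfl fun j _ => Finset.sum_congr rfl fun i _ => by ring

end Gaussian

/-! ### The Metropolis test and symmetrization -/

section Abstract

theorem measureReal_restrict_Iic {e : ℝ} (he : 0 ≤ e) :
    (volume.restrict (Icc (0 : ℝ) 1)).real (Iic e) = min 1 e := by
  rw [measureReal_restrict_apply measurableSet_Iic]
  have : Iic e ∩ Icc (0 : ℝ) 1 = Icc 0 (min 1 e) := by
    ext u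
    simp only [mem_inter_iff, mem_Iic, mem_Icc, le_min_iff]
    tauto
  rw [this, measureReal_def, Real.volume_Icc, sub_zero,
    ENNReal.toReal_ofReal (le_min zero_le_one he)]

instance isProbabilityMeasure_restrict_Icc :
    IsProbabilityMeasure (volume.restrict (Icc (0 : ℝ) 1)) :=
  ⟨by simp⟩

/-- Integrating out the uniform variable of the Metropolis test. -/
theorem hasMean_metropolis {Ω : Type*} [MeasurableSpace Ω] {μ : Measure Ω}
    [IsProbabilityMeasure μ] {B : Set Ω} (hB : MeasurableSet B) {F e w : Ω → ℝ}
    (hF : Measurable F) (he : Measurable e) (he0 : ∀ g, 0 ≤ e g) (hw : Integrable w μ)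
    (hFw : ∀ g ∈ B, |F g| ≤ w g) :
    HasMean (μ.prod (volume.restrict (Icc (0 : ℝ) 1)))
      ({z : Ω × ℝ | z.1 ∈ B ∧ z.2 ≤ e z.1}.indicator fun z => F z.1)
      (∫ g, B.indicator (fun g => F g * min 1 (e g)) g ∂μ) := by
  have hmeas : MeasurableSet {z : Ω × ℝ | z.1 ∈ B ∧ z.2 ≤ e z.1} :=
    (hB.preimage measurable_fst).inter (measurableSet_le measurable_snd (he.comp measurable_fst))
  have hint : Integrable ({z : Ω × ℝ | z.1 ∈ B ∧ z.2 ≤ e z.1}.indicator fun z => F z.1)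
      (μ.prod (volume.restrict (Icc (0 : ℝ) 1))) := by
    refine Integrable.mono (hw.comp_fst (volume.restrict (Icc (0 : ℝ) 1)))
      ((hF.comp measurable_fst).indicator hmeas).aestronglyMeasurable
      (Filter.Eventually.of_forall fun z => ?_)
    by_cases hz : z ∈ {z : Ω × ℝ | z.1 ∈ B ∧ z.2 ≤ e z.1}
    · rw [indicator_of_mem hz]
      exact (hFw _ hz.1).trans (le_abs_self _)
    · rw [indicator_of_notMem hz, norm_zero]
      exact norm_nonneg _
  refine ⟨hint, ?_⟩
  rw [integral_prod _ hint]
  refine integral_congr_ae (Filter.Eventually.of_forall fun g => ?_)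
  by_cases hg : g ∈ B
  · have h1 : ∀ u : ℝ, {z : Ω × ℝ | z.1 ∈ B ∧ z.2 ≤ e z.1}.indicator (fun z => F z.1) (g, u)
        = (Iic (e g)).indicator (fun _ => F g) u := by
      intro u
      by_cases hu : u ≤ e g
      · rw [indicator_of_mem (show (g, u) ∈ {z : Ω × ℝ | z.1 ∈ B ∧ z.2 ≤ e z.1} from ⟨hg, hu⟩),
          indicator_of_mem (show u ∈ Iic (e g) from hu)]
      · rw [indicator_of_notMem fun h => hu h.2, indicator_of_notMem (show u ∉ Iic (e g) from hu)]
    simp only [h1, indicator_of_mem hg]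
    rw [integral_indicator_const _ measurableSet_Iic, measureReal_restrict_Iic (he0 g), smul_eq_mul,
      mul_comm]
  · have h1 : ∀ u : ℝ, {z : Ω × ℝ | z.1 ∈ B ∧ z.2 ≤ e z.1}.indicator (fun z => F z.1) (g, u)
        = 0 := fun u => indicator_of_notMem (fun h => hg h.1) _
    simp only [h1, indicator_of_notMem hg, integral_zero]

/-- Comparison of two integrals against a symmetric measure when the integrands are close only
after symmetrization, and only on the symmetric part of a set `B` whose complement is small. -/
theorem abs_integral_sub_le_of_symm {Ω : Type*} [MeasurableSpace Ω] [InvolutiveNeg Ω]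
    {μ : Measure Ω} [IsProbabilityMeasure μ] (hμ : MeasurePreserving (fun g : Ω => -g) μ μ)
    (hemb : MeasurableEmbedding fun g : Ω => -g) {B : Set Ω} (hB : MeasurableSet B)
    {J Q w : Ω → ℝ} (hJ : Integrable J μ) (hQ : Integrable Q μ) (hw : Integrable w μ)
    (hwneg : ∀ g, w (-g) = w g) {ε η : ℝ} (hε : 0 ≤ ε) (hwB : ∫ g, Bᶜ.indicator w g ∂μ ≤ η)
    (hJw : ∀ g, |J g| ≤ w g) (hQw : ∀ g, |Q g| ≤ w g)
    (hsym : ∀ g ∈ B, -g ∈ B → |1 / 2 * (J g + J (-g)) - Q g| ≤ ε * w g) :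
    |∫ g, J g ∂μ - ∫ g, Q g ∂μ| ≤ ε * ∫ g, w g ∂μ + 4 * η := by
  have hneg : ∀ F : Ω → ℝ, ∫ g, F (-g) ∂μ = ∫ g, F g ∂μ := fun F => hμ.integral_comp hemb F
  have hnegi : ∀ F : Ω → ℝ, Integrable F μ → Integrable (fun g => F (-g)) μ := fun F hF =>
    hμ.integrable_comp_of_integrable hF
  have hw0 : ∀ g, 0 ≤ w g := fun g => (abs_nonneg _).trans (hJw g)
  have hI : Integrable (Bᶜ.indicator w) μ := hw.indicator hB.compl
  have hI0 : ∀ g, 0 ≤ Bᶜ.indicator w g := fun g => indicator_nonneg (fun g _ => hw0 g) g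
  have e1 : ∫ g, J g ∂μ - ∫ g, Q g ∂μ = ∫ g, (1 / 2 * (J g + J (-g)) - Q g) ∂μ := by
    have hJ' : HasMean μ J (∫ g, J g ∂μ) := ⟨hJ, rfl⟩
    have hQ' : HasMean μ Q (∫ g, Q g ∂μ) := ⟨hQ, rfl⟩
    rw [(((hJ'.add ⟨hnegi J hJ, hneg J⟩).const_mul (1 / 2)).sub hQ').2]
    ring
  have hbound : ∀ g, |1 / 2 * (J g + J (-g)) - Q g|
      ≤ ε * w g + (2 * Bᶜ.indicator w g + 2 * Bᶜ.indicator w (-g)) := by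
    intro g
    have h1 := hI0 g
    have h2 := hI0 (-g)
    have h3 := mul_nonneg hε (hw0 g)
    have h4 : |1 / 2 * (J g + J (-g)) - Q g| ≤ 2 * w g := by
      have a1 := abs_le.1 (hJw g)
      have a2 := abs_le.1 (hJw (-g))
      have a3 := abs_le.1 (hQw g)
      rw [hwneg] at a2
      rw [abs_le]
      constructor <;> linarith
    by_cases hg : g ∈ B
    · by_cases hg' : -g ∈ B
      · have := hsym g hg hg'
        linarith
      · rw [indicator_of_mem (show -g ∈ Bᶜ from hg'), hwneg]
        linarith
    · rw [indicator_of_mem (show g ∈ Bᶜ from hg)]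
      linarith
  rw [e1]
  have hw' : HasMean μ w (∫ g, w g ∂μ) := ⟨hw, rfl⟩
  have hI' : HasMean μ (Bᶜ.indicator w) (∫ g, Bᶜ.indicator w g ∂μ) := ⟨hI, rfl⟩
  have hsum := (hw'.const_mul ε).add
    ((hI'.const_mul 2).add (HasMean.const_mul ⟨hnegi _ hI, hneg _⟩ 2))
  refine (norm_integral_le_of_norm_le (f := fun g => 1 / 2 * (J g + J (-g)) - Q g) hsum.1
    (Filter.Eventually.of_forall hbound)).trans ?_
  rw [hsum.2]
  linarith

theorem one_sub_min_exp_le (d : ℝ) : |min 1 (Real.exp (-d)) - 1| ≤ |d| := by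
  have h1 := Real.add_one_le_exp (-d)
  have h2 := Real.exp_pos (-d)
  rw [abs_sub_comm, abs_of_nonneg (by linarith [min_le_left 1 (Real.exp (-d))])]
  rcases le_total 1 (Real.exp (-d)) with h | h
  · rw [min_eq_left h]; simp
  · rw [min_eq_right h]
    exact le_trans (by linarith) (le_abs_self d)

end Abstract

/-! ### Measurability of the proposal -/

section Measurability

variable {m n : ℕ} {O : Set (E m)} {A : Set (X m)} {χ : X m → Fin (n + 1) → X m}

theorem continuous_S : Continuous (S : X m → X m) :=
  continuous_fst.prodMk continuous_snd.neg

theorem continuousOn_psi (hχ : ContinuousOn χ A) : ContinuousOn (psi χ) A :=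
  continuous_S.comp_continuousOn ((continuous_apply (Fin.last n)).comp_continuousOn hχ)

theorem measurableSet_revSet (hA : IsOpen A) (hχ : ContinuousOn χ A) :
    MeasurableSet (revSet A χ) := by
  have hpsi := continuousOn_psi hχ
  let W := A ∩ psi χ ⁻¹' A
  have hW : IsOpen W := hpsi.isOpen_inter_preimage hA hA
  have hl : ∀ j, ContinuousOn (fun x => χ (psi χ x) j) W := fun j =>
    (continuous_apply j).comp_continuousOn
      (hχ.comp (hpsi.mono inter_subset_left) fun x hx => hx.2)
  have hr : ∀ j : Fin (n + 1), ContinuousOn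
      (fun x => S ((Fin.cons x (χ x) : Fin (n + 2) → X m) (Fin.rev j).castSucc)) W := by
    intro j
    refine continuous_S.comp_continuousOn ?_
    induction (Fin.rev j).castSucc using Fin.cases with
    | zero => exact continuousOn_id
    | succ i => exact (continuous_apply i).comp_continuousOn (hχ.mono inter_subset_left)
  have hj : ∀ j : Fin (n + 1), MeasurableSet (W ∩ {x | χ (psi χ x) j =
      S ((Fin.cons x (χ x) : Fin (n + 2) → X m) (Fin.rev j).castSucc)}) := by
    intro j
    have h1 := ((hl j).prodMk (hr j)).isOpen_inter_preimage hW
      (isClosed_diagonal (X := X m)).isOpen_compl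
    have h2 := hW.measurableSet.diff h1.measurableSet
    convert h2 using 1
    ext x
    simp only [mem_inter_iff, mem_ofPred_eq, mem_sdiff, mem_preimage, mem_compl_iff,
      mem_diagonal_iff]
    tauto
  have : revSet A χ = ⋂ j : Fin (n + 1), (W ∩ {x | χ (psi χ x) j =
      S ((Fin.cons x (χ x) : Fin (n + 2) → X m) (Fin.rev j).castSucc)}) := by
    ext x
    simp only [revSet, mem_ofPred_eq, mem_iInter, mem_inter_iff, W, mem_preimage]
    exact ⟨fun h j => ⟨⟨h.1, h.2.1⟩, h.2.2 j⟩,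
      fun h => ⟨(h 0).1.1, (h 0).1.2, fun j => (h j).2⟩⟩
  rw [this]
  exact MeasurableSet.iInter hj

variable {V : E m → ℝ} {D : E m → Matrix (Fin m) (Fin m) ℝ} {a b c : ℝ}

theorem continuousOn_ham (hO : IsOpen O) (hVD : Admissible O V D a b c) :
    ContinuousOn (ham V D) (conf O) := by
  have h1 : ∀ g : E m → ℝ, SmoothPoly O g → ContinuousOn (fun x : X m => g x.1) (conf O) :=
    fun g hg => hg.1.continuousOn.comp continuous_fst.continuousOn fun x hx => hx
  have h2 : ∀ i, Continuous fun x : X m => x.2 i := fun i =>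
    (EuclideanSpace.proj i : E m →L[ℝ] ℝ).continuous.comp continuous_snd
  have e : ham V D = fun x : X m =>
      pot V D x.1 + 1 / 2 * ∑ i, ∑ j, D x.1 i j * x.2 i * x.2 j := funext fun x => ham_eq x
  rw [e]
  exact (h1 _ (hVD.pot_smooth hO)).add (continuousOn_const.mul
    (continuousOn_finsetSum _ fun i _ => continuousOn_finsetSum _ fun j _ =>
      ((h1 _ (hVD.D_smooth i j)).mul (h2 i).continuousOn).mul (h2 j).continuousOn))

theorem ham_S (x : X m) : ham V D (S x) = ham V D x := by
  simp [ham, S, Matrix.mulVec_neg]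

/-- One step of the algorithm, after the uniform variable has been integrated out: `J` is the mean
increment of `f` given the Gaussian variable. -/
theorem hasMean_hmc (hO : IsOpen O) (hVD : Admissible O V D a b c) (hA : IsOpen A)
    (hAO : A ⊆ conf O) (hχO : ∀ x ∈ A, ∀ i, χ x i ∈ conf O) (hχ : ContinuousOn χ A) {f : E m → ℝ}
    (hf : SmoothPoly O f) (q : E m) {w : E m → ℝ} (hw : Integrable w (stdGaussian (E m)))
    (hbound : ∀ g, (q, invSqrtMul (D q) g) ∈ A →
      |f (flow χ (q, invSqrtMul (D q) g)).1 - f q| ≤ w g) :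
    MeasurableSet {g | (q, invSqrtMul (D q) g) ∈ revSet A χ} ∧
    ∃ J : E m → ℝ, Measurable J ∧
      (∀ g, (q, invSqrtMul (D q) g) ∈ revSet A χ →
        J g = (f (flow χ (q, invSqrtMul (D q) g)).1 - f q)
          * min 1 (Real.exp (-(ham V D (flow χ (q, invSqrtMul (D q) g))
            - ham V D (q, invSqrtMul (D q) g))))) ∧
      (∀ g, (q, invSqrtMul (D q) g) ∉ revSet A χ → J g = 0) ∧
      HasMean (noise m) (fun z => f (hmcPosition V D A χ q z.1 z.2))
        (f q + ∫ g, J g ∂(stdGaussian (E m))) := by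
  classical
  let x : E m → X m := fun g => (q, invSqrtMul (D q) g)
  have hx : Continuous x := continuous_const.prodMk (continuous_invSqrtMul _)
  let B : Set (E m) := {g | x g ∈ revSet A χ}
  have hB : MeasurableSet B := hx.measurable (measurableSet_revSet hA hχ)
  let A' : Set (E m) := x ⁻¹' A
  have hA' : MeasurableSet A' := (hA.preimage hx).measurableSet
  have hBA : ∀ g ∈ B, g ∈ A' := fun g hg => hg.1
  have hflow : ContinuousOn (flow χ) A := (continuous_apply (Fin.last n)).comp_continuousOn hχ
  have hfx : ContinuousOn (fun g => flow χ (x g)) A' :=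
    hflow.comp hx.continuousOn fun g hg => hg
  let F : E m → ℝ := A'.piecewise (fun g => f (flow χ (x g)).1 - f q) 0
  have hF : Measurable F := by
    refine ContinuousOn.measurable_piecewise ?_ continuousOn_const hA'
    refine ContinuousOn.sub ?_ continuousOn_const
    exact hf.1.continuousOn.comp (continuous_fst.comp_continuousOn hfx)
      fun g hg => hχO _ hg _
  let e : E m → ℝ := A'.piecewise
    (fun g => Real.exp (-(ham V D (flow χ (x g)) - ham V D (x g)))) 0
  have hham := continuousOn_ham hO hVD
  have he : Measurable e := by
    refine ContinuousOn.measurable_piecewise ?_ continuousOn_const hA'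
    refine Real.continuous_exp.comp_continuousOn (ContinuousOn.neg (ContinuousOn.sub ?_ ?_))
    · exact hham.comp hfx fun g hg => hχO _ hg _
    · exact hham.comp hx.continuousOn fun g hg => hAO hg
  have he0 : ∀ g, 0 ≤ e g := by
    intro g
    by_cases hg : g ∈ A'
    · simp only [e, piecewise_eq_of_mem _ _ _ hg]
      exact (Real.exp_pos _).le
    · simp only [e, piecewise_eq_of_notMem _ _ _ hg, Pi.zero_apply, le_refl]
  have hFB : ∀ g ∈ B, F g = f (flow χ (x g)).1 - f q := fun g hg =>
    piecewise_eq_of_mem _ _ _ (hBA g hg)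
  have heB : ∀ g ∈ B, e g = Real.exp (-(ham V D (flow χ (x g)) - ham V D (x g))) := fun g hg =>
    piecewise_eq_of_mem _ _ _ (hBA g hg)
  have hmean := hasMean_metropolis hB hF he he0 hw fun g hg => by
    rw [hFB g hg]
    exact hbound g (hBA g hg)
  refine ⟨hB, B.indicator (fun g => F g * min 1 (e g)),
    (hF.mul (measurable_const.min he)).indicator hB, fun g hg => ?_, fun g hg => ?_, ?_⟩
  · rw [indicator_of_mem (show g ∈ B from hg), hFB g hg, heB g hg]
  · exact indicator_of_notMem (show g ∉ B from hg) _
  · have hval : (fun z : E m × ℝ => f (hmcPosition V D A χ q z.1 z.2)) = fun z =>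
        f q + {z : E m × ℝ | z.1 ∈ B ∧ z.2 ≤ e z.1}.indicator (fun z => F z.1) z := by
      ext ⟨g, u⟩
      by_cases hg : g ∈ B
      · have hrev : psiRev A χ (x g) = psi χ (x g) := if_pos hg
        have hexp : Real.exp (-ham V D (psi χ (x g)) + ham V D (x g)) = e g := by
          rw [heB g hg, psi, ham_S]
          congr 1
          ring
        by_cases hu : u ≤ e g
        · rw [indicator_of_mem (show (g, u) ∈ {z : E m × ℝ | z.1 ∈ B ∧ z.2 ≤ e z.1} from ⟨hg, hu⟩)]
          simp only [hmcPosition]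
          rw [show psiRev A χ (q, invSqrtMul (D q) g) = psi χ (x g) from hrev,
            show Real.exp (-ham V D (psi χ (x g)) + ham V D (q, invSqrtMul (D q) g)) = e g
              from hexp,
            if_pos hu, hFB g hg]
          simp [psi, S]
        · rw [indicator_of_notMem fun h => hu h.2]
          simp only [hmcPosition]
          rw [show psiRev A χ (q, invSqrtMul (D q) g) = psi χ (x g) from hrev,
            show Real.exp (-ham V D (psi χ (x g)) + ham V D (q, invSqrtMul (D q) g)) = e g
              from hexp,
            if_neg hu, add_zero]
      · have hrev : psiRev A χ (q, invSqrtMul (D q) g) = (q, invSqrtMul (D q) g) := if_neg hg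
        rw [indicator_of_notMem fun h => hg h.1]
        simp only [hmcPosition, hrev, ite_self, add_zero]
    rw [hval]
    have : IsProbabilityMeasure (noise m) := inferInstanceAs (IsProbabilityMeasure
      ((stdGaussian (E m)).prod (volume.restrict (Icc (0 : ℝ) 1))))
    exact (hasMean_const (f q)).add hmean

end Measurability

/-! ### Uniform bounds for one step -/

section Bounds

variable {m : ℕ} {O : Set (E m)} {V : E m → ℝ} {D : E m → Matrix (Fin m) (Fin m) ℝ} {a b c : ℝ}

theorem polyO_secondOrder {ι : Type*} {σ : Scale ι} (hO : IsOpen O)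
    (hVD : Admissible O V D a b c) {f : E m → ℝ} (hf : SmoothPoly O f) {q p : ι → E m}
    (hqO : ∀ i, q i ∈ O) (hq : PolyOVec σ 0 q) (hp : PolyOVec σ 0 p) :
    PolyO σ 0 fun x => secondOrder V D f (q x) (p x) := by
  have hD := fun i j => (hVD.D_smooth i j).polyO_comp hq hqO
  have hdD := fun i j k => ((hVD.D_smooth i j).pd hO k).polyO_comp hq hqO
  have hDp := fun i => PolyO.sum Finset.univ fun l _ => (hD i l).mul (hp.apply l)
  have hF := fun j => polyO_force hO hVD hq hqO hp j
  exact (PolyO.sum Finset.univ fun i _ => ((hf.pd hO i).polyO_comp hq hqO).mul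
    ((PolyO.sum Finset.univ fun j _ => (PolyO.sum Finset.univ fun k _ =>
      (hDp k).mul (hdD i j k)).mul (hp.apply j)).sub
    (PolyO.sum Finset.univ fun j _ => (hD i j).mul (hF j)))).add
    (PolyO.sum Finset.univ fun j _ => PolyO.sum Finset.univ fun i _ =>
      ((hDp j).mul (hDp i)).mul (((hf.pd hO j).pd hO i).polyO_comp hq hqO))

/-- The estimates on one step with constants which do not depend on the time step, the position
and the momentum: the increment of `f`, the effect of rejection, and the symmetrized increment. -/
theorem exists_step_bounds (hO : IsOpen O) (hconv : Convex ℝ O) (hVD : Admissible O V D a b c)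
    {s : Scheme} {dtStar : ℝ} {A : ℝ → Set (X m)} {χ : ℝ → X m → Fin (s.inner + 1) → X m}
    {K δ : ℝ}
    (hχ : ∀ dt ∈ Ioc 0 dtStar, IsNumericalSolver O (s.phi (ham V D) dt) (A dt) (χ dt))
    (hδ : 0 ≤ δ)
    (hlocal : ∀ dt ∈ Ioc 0 dtStar, ∀ x ∈ A dt, ∃ γ : ℝ → X m,
      IsHamTrajectory O (ham V D) dt x γ ∧
      ‖flow (χ dt) x - γ dt‖ ≤ K * dt ^ 3 * (1 + ‖x.1‖ ^ δ + ‖x.2‖ ^ δ))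
    {f : E m → ℝ} (hf : SmoothPoly O f) :
    ∃ Λ : ℝ, 0 ≤ Λ ∧ ∃ N : ℕ, ∀ dt ∈ Ioc 0 dtStar, ∀ q ∈ O, ∀ p : E m,
      ((q, p) ∈ A dt →
        |f (flow (χ dt) (q, p)).1 - f q| ≤ Λ * (1 + ‖q‖ + ‖p‖) ^ N ∧
        |(f (flow (χ dt) (q, p)).1 - f q) * (ham V D (flow (χ dt) (q, p)) - ham V D (q, p))|
          ≤ Λ * (1 + ‖q‖ + ‖p‖) ^ N * dt ^ 4) ∧
      ((q, p) ∈ A dt → (q, -p) ∈ A dt →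
        |1 / 2 * (f (flow (χ dt) (q, p)).1 + f (flow (χ dt) (q, -p)).1) - f q
          - dt ^ 2 / 2 * secondOrder V D f q p| ≤ Λ * (1 + ‖q‖ + ‖p‖) ^ N * dt ^ 4) ∧
      |dt ^ 2 / 2 * secondOrder V D f q p| ≤ Λ * (1 + ‖q‖ + ‖p‖) ^ N := by
  obtain ⟨h1, h2⟩ := polyOVec_flow hO hconv hVD hχ hδ hlocal
  have hxO : ∀ i : StepIndex dtStar A, i.1.2.1 ∈ O := fun i => (hχ i.1.1 i.2.1).subset i.2.2
  have hyO : ∀ i : StepIndex dtStar A, (flow (χ i.1.1) i.1.2).1 ∈ O := fun i =>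
    (hχ i.1.1 i.2.1).mapsTo _ i.2.2 _
  have h3 := hf.polyO_sub hO hconv (polyOVec_stepScale dtStar A).1 hxO hyO h1
  obtain ⟨C1, hC1, N1, b1⟩ := h3.weaken (Nat.zero_le 1)
  obtain ⟨C2, hC2, N2, b2⟩ := h3.mul h2
  obtain ⟨C3, hC3, N3, b3⟩ := polyO_symm_average hO hconv hVD hχ h1 hf
  have h4 := polyO_secondOrder (σ := stepScale dtStar fun _ => conf O) hO hVD hf
    (fun i => i.2.2) (polyOVec_stepScale _ _).1 (polyOVec_stepScale _ _).2
  obtain ⟨C4, hC4, N4, b4⟩ :=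
    ((h4.h_mul.h_mul).weaken (Nat.zero_le _)).const_mul (1 / 2)
  refine ⟨C1 + C2 + C3 + C4, by positivity, N1 + N2 + N3 + N4, fun dt hdt q hq p => ?_⟩
  have hw : 1 ≤ 1 + ‖q‖ + ‖p‖ := by linarith [norm_nonneg q, norm_nonneg p]
  have hdt0 : 0 ≤ dt := hdt.1.le
  have key : ∀ C N, C ≤ C1 + C2 + C3 + C4 → N ≤ N1 + N2 + N3 + N4 →
      C * (1 + ‖q‖ + ‖p‖) ^ N
        ≤ (C1 + C2 + C3 + C4) * (1 + ‖q‖ + ‖p‖) ^ (N1 + N2 + N3 + N4) := by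
    intro C N hC hN
    gcongr
  refine ⟨fun hx => ⟨?_, ?_⟩, fun hx hx' => ?_, ?_⟩
  · have := b1 ⟨(dt, (q, p)), hdt, hx⟩
    rw [pow_zero, mul_one] at this
    exact this.trans (key C1 N1 (by linarith) (by omega))
  · exact (b2 ⟨(dt, (q, p)), hdt, hx⟩).trans
      (mul_le_mul_of_nonneg_right (key C2 N2 (by linarith) (by omega)) (pow_nonneg hdt0 4))
  · exact (b3 ⟨(dt, (q, p)), hdt, hx, hx'⟩).trans
      (mul_le_mul_of_nonneg_right (key C3 N3 (by linarith) (by omega)) (pow_nonneg hdt0 4))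
  · have := b4 ⟨(dt, (q, p)), hdt, hq⟩
    rw [pow_zero, mul_one] at this
    refine le_trans (le_of_eq ?_) (this.trans (key C4 N4 (by linarith) (by omega)))
    congr 1
    change _ = 1 / 2 * (dt * (dt * secondOrder V D f q p))
    ring

/-- The scale of a single non-negative variable `t`, with weight `1 + t` and without a small
parameter. -/
def growthScale : Scale {t : ℝ // 0 ≤ t} where
  w := fun t => 1 + t.1
  h := fun _ => 1
  one_le_w := fun t => by linarith [t.2]
  h_pos := fun _ => one_pos
  exists_h_le := ⟨1, fun _ => le_rfl⟩

theorem PolyO.exists_rpow_bound {G : {t : ℝ // 0 ≤ t} → ℝ} (hG : PolyO growthScale 0 G) :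
    ∃ C α : ℝ, 0 ≤ C ∧ 0 ≤ α ∧ ∀ t : {t : ℝ // 0 ≤ t}, G t ≤ C * (1 + t.1 ^ α) := by
  obtain ⟨C, hC, N, h⟩ := hG
  refine ⟨C * 2 ^ N, N, by positivity, by positivity, fun t => ?_⟩
  have h1 := h t
  rw [pow_zero, mul_one] at h1
  rw [Real.rpow_natCast, mul_assoc]
  refine ((le_abs_self _).trans h1).trans ?_
  gcongr
  exact one_add_pow_le t.1 t.2 N

theorem rpow_le_of_le {s t e e' : ℝ} (ht : 0 < t) (hts : t ≤ s) (he : e ≤ e') :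
    t ^ e' ≤ s ^ (e' - e) * t ^ e := by
  have : t ^ e' = t ^ (e' - e) * t ^ e := by rw [← Real.rpow_add ht]; congr 1; ring
  rw [this]
  gcongr

/-- One step of the algorithm from a fixed position, compared with the generator. -/
theorem hmc_step_estimate (hO : IsOpen O) (hVD : Admissible O V D a b c)
    {s : Scheme} {dt : ℝ} (hdt : 0 < dt) {A : Set (X m)} {χ : X m → Fin (s.inner + 1) → X m}
    (hχ : IsNumericalSolver O (s.phi (ham V D) dt) A χ) {f : E m → ℝ} (hf : SmoothPoly O f)
    {Λ : ℝ} (hΛ : 0 ≤ Λ) {N : ℕ} {q : E m} (hq : q ∈ O)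
    (hb : ∀ p : E m, ((q, p) ∈ A →
        |f (flow χ (q, p)).1 - f q| ≤ Λ * (1 + ‖q‖ + ‖p‖) ^ N ∧
        |(f (flow χ (q, p)).1 - f q) * (ham V D (flow χ (q, p)) - ham V D (q, p))|
          ≤ Λ * (1 + ‖q‖ + ‖p‖) ^ N * dt ^ 4) ∧
      ((q, p) ∈ A → (q, -p) ∈ A →
        |1 / 2 * (f (flow χ (q, p)).1 + f (flow χ (q, -p)).1) - f q
          - dt ^ 2 / 2 * secondOrder V D f q p| ≤ Λ * (1 + ‖q‖ + ‖p‖) ^ N * dt ^ 4) ∧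
      |dt ^ 2 / 2 * secondOrder V D f q p| ≤ Λ * (1 + ‖q‖ + ‖p‖) ^ N)
    {R₀ R : ℝ}
    (hrev₀ : ∫ g, {g : E m | (q, invSqrtMul (D q) g) ∉ revSet A χ}.indicator
      (fun g => ‖g‖ ^ 0) g ∂(stdGaussian (E m)) ≤ R₀)
    (hrev : ∫ g, {g : E m | (q, invSqrtMul (D q) g) ∉ revSet A χ}.indicator
      (fun g => ‖g‖ ^ N) g ∂(stdGaussian (E m)) ≤ R) :
    Integrable (fun z : E m × ℝ => f (hmcPosition V D A χ q z.1 z.2)) (noise m) ∧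
    |∫ z, f (hmcPosition V D A χ q z.1 z.2) ∂(noise m) - (f q + dt ^ 2 / 2 * gen V D f q)|
      ≤ Λ * ((1 + a⁻¹) * (1 + ‖q‖)) ^ N *
        (2 * dt ^ 4 * ∫ g : E m, (1 + ‖g‖) ^ N ∂(stdGaussian (E m))
          + 4 * (2 ^ N * (R₀ + R))) := by
  set κ : ℝ := (1 + a⁻¹) * (1 + ‖q‖) with hκ
  have ha : 0 < a⁻¹ := inv_pos.2 hVD.a_pos
  have hκ0 : 0 ≤ κ := by positivity
  let w : E m → ℝ := fun g => Λ * κ ^ N * (1 + ‖g‖) ^ N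
  have hpow : Integrable (fun g : E m => (1 + ‖g‖) ^ N) (stdGaussian (E m)) := by
    refine Integrable.mono' (((integrable_const 1).add
      (integrable_norm_pow_stdGaussian N)).const_mul (2 ^ N)) (by fun_prop)
      (Filter.Eventually.of_forall fun g => ?_)
    rw [Real.norm_eq_abs, abs_of_nonneg (by positivity)]
    exact one_add_pow_le _ (norm_nonneg g) N
  have hw : Integrable w (stdGaussian (E m)) := hpow.const_mul _
  -- the weight in the momentum is controlled by the weight in the Gaussian variable
  have hWw : ∀ g : E m, Λ * (1 + ‖q‖ + ‖invSqrtMul (D q) g‖) ^ N ≤ w g := by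
    intro g
    have h1 := norm_invSqrtMul_le (hVD.posDef q hq) hVD.a_pos (hVD.lower q hq) g
    have h2 : 1 + ‖q‖ + ‖invSqrtMul (D q) g‖ ≤ κ * (1 + ‖g‖) := by
      have h3 := norm_nonneg q
      have h4 := norm_nonneg g
      have h5 : 0 ≤ a⁻¹ * ‖q‖ * (1 + ‖g‖) := by positivity
      have h6 : 0 ≤ ‖q‖ * ‖g‖ := by positivity
      rw [hκ]
      nlinarith
    simp only [w]
    rw [mul_assoc, ← mul_pow]
    gcongr
  have hd : ∀ g, (q, invSqrtMul (D q) g) ∈ A →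
      |f (flow χ (q, invSqrtMul (D q) g)).1 - f q| ≤ w g := fun g hg =>
    (((hb _).1 hg).1).trans (hWw g)
  obtain ⟨hB, J, hJm, hJ1, hJ0, hmean⟩ := hasMean_hmc hO hVD hχ.isOpen hχ.subset hχ.mapsTo
    hχ.continuousOn hf q hw hd
  refine ⟨hmean.1, ?_⟩
  have hw0 : ∀ g, 0 ≤ w g := fun g => by positivity
  have hJw : ∀ g, |J g| ≤ w g := by
    intro g
    by_cases hg : (q, invSqrtMul (D q) g) ∈ revSet A χ
    · rw [hJ1 g hg, abs_mul]
      refine (mul_le_of_le_one_right (abs_nonneg _) ?_).trans (hd g hg.1)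
      rw [abs_of_nonneg (le_min zero_le_one (Real.exp_pos _).le)]
      exact min_le_left _ _
    · rw [hJ0 g hg, abs_zero]
      exact hw0 g
  have hQ := (hasMean_secondOrder hO hVD f hq).const_mul (dt ^ 2 / 2)
  have hmain := abs_integral_sub_le_of_symm measurePreserving_neg_stdGaussian
    (MeasurableEquiv.neg (E m)).measurableEmbedding hB
    (hw.mono' hJm.aestronglyMeasurable (Filter.Eventually.of_forall hJw)) hQ.1 hw
    (fun g => by simp only [w, norm_neg]) (ε := 2 * dt ^ 4)
    (η := Λ * κ ^ N * (2 ^ N * (R₀ + R))) (by positivity) ?_ hJw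
    (fun g => ((hb _).2.2).trans (hWw g)) ?_
  · rw [hmean.2, add_sub_add_left_eq_sub, ← hQ.2]
    refine hmain.trans (le_of_eq ?_)
    simp only [w]
    rw [integral_const_mul]
    ring
  · set B : Set (E m) := {g | (q, invSqrtMul (D q) g) ∈ revSet A χ} with hBdef
    have hI : ∀ n : ℕ, Integrable (Bᶜ.indicator fun g : E m => ‖g‖ ^ n) (stdGaussian (E m)) :=
      fun n => (integrable_norm_pow_stdGaussian n).indicator hB.compl
    have h1 : ∀ g, Bᶜ.indicator w g ≤ Λ * κ ^ N * 2 ^ N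
        * (Bᶜ.indicator (fun g : E m => ‖g‖ ^ 0) g + Bᶜ.indicator (fun g : E m => ‖g‖ ^ N) g) := by
      intro g
      by_cases hg : g ∈ Bᶜ
      · simp only [indicator_of_mem hg, w]
        rw [mul_assoc (Λ * κ ^ N)]
        gcongr
        rw [pow_zero]
        exact one_add_pow_le _ (norm_nonneg g) N
      · simp only [indicator_of_notMem hg]
        simp
    refine (integral_mono (hw.indicator hB.compl) (((hI 0).add (hI N)).const_mul _) h1).trans ?_
    rw [integral_const_mul]
    have h2 : ∫ g, (Bᶜ.indicator (fun g : E m => ‖g‖ ^ 0) g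
        + Bᶜ.indicator (fun g : E m => ‖g‖ ^ N) g) ∂(stdGaussian (E m)) ≤ R₀ + R := by
      rw [integral_add (hI 0) (hI N)]
      exact add_le_add hrev₀ hrev
    calc _ ≤ Λ * κ ^ N * 2 ^ N * (R₀ + R) := by
          refine mul_le_mul_of_nonneg_left h2 (by positivity)
      _ = _ := by ring
  · intro g hg hg'
    have hg'2 : (q, -invSqrtMul (D q) g) ∈ revSet A χ := by
      rw [← invSqrtMul_neg]
      exact hg'
    rw [hJ1 g hg, hJ1 (-g) hg', invSqrtMul_neg]
    have c1 := ((hb (invSqrtMul (D q) g)).1 hg.1).2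
    have c2 := ((hb (-invSqrtMul (D q) g)).1 hg'2.1).2
    have c3 := (hb (invSqrtMul (D q) g)).2.1 hg.1 hg'2.1
    rw [norm_neg] at c2
    have hwg : Λ * (1 + ‖q‖ + ‖invSqrtMul (D q) g‖) ^ N * dt ^ 4 ≤ w g * dt ^ 4 :=
      mul_le_mul_of_nonneg_right (hWw g) (by positivity)
    -- replacing the acceptance probability by one costs `|f(y) - f(q)| |H(y) - H(x)|`
    have hrej : ∀ d e : ℝ, |d * e| ≤ w g * dt ^ 4 →
        |d * min 1 (Real.exp (-e)) - d| ≤ w g * dt ^ 4 := by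
      intro d e hde
      have : d * min 1 (Real.exp (-e)) - d = d * (min 1 (Real.exp (-e)) - 1) := by ring
      rw [this, abs_mul]
      refine le_trans ?_ hde
      rw [abs_mul]
      exact mul_le_mul_of_nonneg_left (one_sub_min_exp_le e) (abs_nonneg d)
    have d1 := abs_le.1 (hrej _ _ (c1.trans hwg))
    have d2 := abs_le.1 (hrej _ _ (c2.trans hwg))
    have d3 := abs_le.1 (c3.trans hwg)
    rw [abs_le]
    constructor <;> linarith [d1.1, d1.2, d2.1, d2.2, d3.1, d3.2]

end Bounds

end RMHMC

theorem mainTheorem4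
    {m : ℕ} (O : Set (RMHMC.E m)) (hO : IsOpen O) (hOconv : Convex ℝ O)
    (V : RMHMC.E m → ℝ) (D : RMHMC.E m → Matrix (Fin m) (Fin m) ℝ) (a b c : ℝ)
    (hVD : RMHMC.Admissible O V D a b c)
    -- the scheme (IMR or GSV) and a numerical solver for it, for each time step
    (s : RMHMC.Scheme) (dtStar : ℝ) (hdtStar : 0 < dtStar)
    (A : ℝ → Set (RMHMC.X m))
    (χ : ℝ → RMHMC.X m → Fin (s.inner + 1) → RMHMC.X m)
    (hχ : ∀ dt ∈ Set.Ioc 0 dtStar,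
      RMHMC.IsNumericalSolver O (s.phi (RMHMC.ham V D) dt) (A dt) (χ dt))
    (hclose : ∀ x ∈ RMHMC.conf O, ∃ τ : ℝ, 0 < τ ∧ ∃ C : ℝ,
      ∀ dt ∈ Set.Ioc 0 (min τ dtStar), x ∈ A dt → ∀ i, ‖χ dt x i - x‖ ≤ C * dt)
    -- for each initial position, the overdamped Langevin dynamics
    {Ω : Type*} [MeasurableSpace Ω] (P : RMHMC.E m → Measure Ω)
    (Y : RMHMC.E m → ℝ≥0 → Ω → RMHMC.E m)
    (hY : ∀ q ∈ O, RMHMC.SolvesLangevin O V D q (P q) (Y q))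
    (f : RMHMC.E m → ℝ) (hf : RMHMC.SmoothPoly O f)
    (K δ : ℝ) (hK : 0 ≤ K) (hδ : 0 ≤ δ)
    -- stability of the semigroup `(exp(tℒ) f)(q) = 𝔼^q[f(q_t)]`
    (hstab : ∀ t ∈ Set.Ioc 0 dtStar, ∀ q ∈ O,
      Integrable (fun w => f (Y q (Real.toNNReal t) w)) (P q) ∧
      |(∫ w, f (Y q (Real.toNNReal t) w) ∂(P q)) - (f q + t * RMHMC.gen V D f q)|
        ≤ K * t ^ 2 * (1 + ‖q‖ ^ δ))
    -- local error with respect to the exact Hamiltonian flow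
    (hlocal : ∀ dt ∈ Set.Ioc 0 dtStar, ∀ x ∈ A dt, ∃ γ : ℝ → RMHMC.X m,
      RMHMC.IsHamTrajectory O (RMHMC.ham V D) dt x γ ∧
      ‖RMHMC.flow (χ dt) x - γ dt‖ ≤ K * dt ^ 3 * (1 + ‖x.1‖ ^ δ + ‖x.2‖ ^ δ))
    -- Gaussian moments on the failure of the reversibility check
    (r₃ : ℝ) (hr₃ : 0 < r₃)
    (hrev : ∀ n : ℕ, ∃ Cn bn : ℝ, 0 ≤ Cn ∧ 0 ≤ bn ∧
      ∀ dt ∈ Set.Ioc 0 dtStar, ∀ q ∈ O,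
        (∫ g, {g : RMHMC.E m | (q, RMHMC.invSqrtMul (D q) g) ∉
              RMHMC.revSet (A dt) (χ dt)}.indicator (fun g => ‖g‖ ^ n) g
            ∂(stdGaussian (RMHMC.E m)))
          ≤ Cn * (1 + ‖q‖ ^ bn) * dt ^ (2 * (r₃ + 1))) :
    ∃ C α : ℝ, 0 ≤ C ∧ 0 ≤ α ∧
      ∀ dt ∈ Set.Ioc 0 dtStar, dt ^ 2 / 2 ≤ dtStar → ∀ q ∈ O,
        Integrable (fun z : RMHMC.E m × ℝ =>
          f (RMHMC.hmcPosition V D (A dt) (χ dt) q z.1 z.2)) (RMHMC.noise m) ∧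
        |(∫ z, f (RMHMC.hmcPosition V D (A dt) (χ dt) q z.1 z.2) ∂(RMHMC.noise m))
            - ∫ w, f (Y q (Real.toNNReal (dt ^ 2 / 2)) w) ∂(P q)|
          ≤ C * (1 + ‖q‖ ^ α) * dt ^ (2 * (min 1 r₃ + 1)) := by
  obtain ⟨Λ, hΛ, N, hbounds⟩ := RMHMC.exists_step_bounds hO hOconv hVD hχ hδ hlocal hf
  obtain ⟨C₀, b₀, hC₀, hb₀, hrev₀⟩ := hrev 0
  obtain ⟨C₁, b₁, hC₁, hb₁, hrev₁⟩ := hrev N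
  set e : ℝ := 2 * (min 1 r₃ + 1) with he
  set M : ℝ := ∫ g : RMHMC.E m, (1 + ‖g‖) ^ N ∂(stdGaussian (RMHMC.E m)) with hM
  have hM0 : 0 ≤ M := integral_nonneg fun g => by positivity
  -- `c₁`, `c₂` are the cost of lowering the powers of `dt ≤ dtStar` to the exponent `e`
  set c₁ : ℝ := dtStar ^ (4 - e)
  set c₂ : ℝ := dtStar ^ (2 * (r₃ + 1) - e)
  -- the bound that results for a position of norm `t`, up to the factor `dt ^ e`
  let G : {t : ℝ // 0 ≤ t} → ℝ := fun t =>
    Λ * ((1 + a⁻¹) * (1 + t.1)) ^ N * (2 * c₁ * M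
      + 4 * (2 ^ N * (C₀ * (1 + t.1 ^ b₀) * c₂ + C₁ * (1 + t.1 ^ b₁) * c₂)))
      + K / 4 * c₁ * (1 + t.1 ^ δ)
  have hG : RMHMC.PolyO RMHMC.growthScale 0 G := by
    let σ := RMHMC.growthScale
    have h1 : ∀ c, RMHMC.PolyO σ 0 fun _ => c := RMHMC.polyO_const σ
    have ht : RMHMC.PolyO σ 0 fun t => t.1 := (RMHMC.polyO_w σ).of_le fun t => by
      change |t.1| ≤ |1 + t.1|
      rw [abs_of_nonneg t.2, abs_of_nonneg (by linarith [t.2])]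
      linarith
    have hr : ∀ β : ℝ, 0 ≤ β → RMHMC.PolyO σ 0 fun t => 1 + t.1 ^ β := fun β hβ =>
      (h1 1).add (ht.rpow (fun t => t.2) hβ)
    exact (((h1 Λ).mul (((h1 (1 + a⁻¹)).mul ((h1 1).add ht)).pow N)).mul ((h1 (2 * c₁ * M)).add
      (((((h1 C₀).mul (hr b₀ hb₀)).mul (h1 c₂)).add
        (((h1 C₁).mul (hr b₁ hb₁)).mul (h1 c₂))).const_mul (2 ^ N) |>.const_mul 4))).add
      ((h1 (K / 4 * c₁)).mul (hr δ hδ))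
  obtain ⟨C, α, hC, hα, hfin⟩ := hG.exists_rpow_bound
  refine ⟨C, α, hC, hα, fun dt hdt hdt2 q hq => ?_⟩
  have hdt0 : 0 < dt := hdt.1
  obtain ⟨hint, hest⟩ := RMHMC.hmc_step_estimate hO hVD hdt0 (hχ dt hdt) hf hΛ hq
    (hbounds dt hdt q hq) (hrev₀ dt hdt q hq) (hrev₁ dt hdt q hq)
  refine ⟨hint, ?_⟩
  have hY2 := (hstab (dt ^ 2 / 2) ⟨by positivity, hdt2⟩ q hq).2
  have hp4 : dt ^ 4 ≤ c₁ * dt ^ e := by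
    have := RMHMC.rpow_le_of_le (e := e) (e' := 4) hdt0 hdt.2
      (by linarith [min_le_left 1 r₃])
    rwa [Real.rpow_ofNat] at this
  have hpr : dt ^ (2 * (r₃ + 1)) ≤ c₂ * dt ^ e :=
    RMHMC.rpow_le_of_le hdt0 hdt.2 (by linarith [min_le_right 1 r₃])
  have ha : 0 < a⁻¹ := inv_pos.2 hVD.a_pos
  have h1 : Λ * ((1 + a⁻¹) * (1 + ‖q‖)) ^ N * (2 * dt ^ 4 * M
      + 4 * (2 ^ N * (C₀ * (1 + ‖q‖ ^ b₀) * dt ^ (2 * (r₃ + 1))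
        + C₁ * (1 + ‖q‖ ^ b₁) * dt ^ (2 * (r₃ + 1)))))
      + K * (dt ^ 2 / 2) ^ 2 * (1 + ‖q‖ ^ δ)
      ≤ G ⟨‖q‖, norm_nonneg q⟩ * dt ^ e := by
    calc _ = Λ * ((1 + a⁻¹) * (1 + ‖q‖)) ^ N * (2 * dt ^ 4 * M
          + 4 * (2 ^ N * (C₀ * (1 + ‖q‖ ^ b₀) * dt ^ (2 * (r₃ + 1))
            + C₁ * (1 + ‖q‖ ^ b₁) * dt ^ (2 * (r₃ + 1)))))
          + K / 4 * dt ^ 4 * (1 + ‖q‖ ^ δ) := by ring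
      _ ≤ Λ * ((1 + a⁻¹) * (1 + ‖q‖)) ^ N * (2 * (c₁ * dt ^ e) * M
          + 4 * (2 ^ N * (C₀ * (1 + ‖q‖ ^ b₀) * (c₂ * dt ^ e)
            + C₁ * (1 + ‖q‖ ^ b₁) * (c₂ * dt ^ e))))
          + K / 4 * (c₁ * dt ^ e) * (1 + ‖q‖ ^ δ) := by gcongr
      _ = _ := by simp only [G]; ring
  have h2 := mul_le_mul_of_nonneg_right (hfin ⟨‖q‖, norm_nonneg q⟩)
    (Real.rpow_nonneg hdt0.le e)
  rw [abs_le] at hest hY2 ⊢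
  constructor <;> linarith [hest.1, hest.2, hY2.1, hY2.2]
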